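/- Let $\ell\ge 1$ and let $\Gamma_1,\dots,\Gamma_{2\ell+1}$ be the Clifford matrices on $(\mathbb C^2)^{\otimes \ell}$: for $\ell=1$ they are the Pauli matrices $X,Y,Z$, and for $\ell>1$ they are $X\otimes\Gamma'_i$ ($1\le i\le 2\ell-1$, with $\Gamma'_i$ the Clifford matrices for $\ell-1$), $Y\otimes \mathbb 1$, $Z\otimes\mathbb 1$. Put $\Gamma^{ab}=-i\,\Gamma_a\Gamma_b$ for $a\ne b$. The $SO(2\ell+1)$ AKLT state with on-site adjoint irrep (dimension $\ell(2\ell+1)$) and virtual spinor irrep (dimension $2^\ell$) is the matrix product state $\sum_{i_1,\dots,i_n}\langle R|A_{i_1}\cdots A_{i_n}|L\rangle\,|i_1\dots i_n\rangle$ with Kraus operators $A_{ab}=\Gamma^{ab}/\sqrt{\ell(2\ell+1)}$, $a<b$. For $g\in SO(2\ell+1)$ let $U(g)$ be the adjoint representation matrix, $U(g)_{ab,mn}=g_{am}g_{bn}-g_{an}g_{bm}$ ($a<b$, $m<n$). Measuring a site in the basis rotated by $U(g)$, $\langle w_i|=\sum_j U(g)_{ij}\langle j|$, with outcome $i$ enacts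 $\tilde A_i=\sum_j U(g)_{ij}A_j$ on the virtual space. If the sites $1,\dots,n$ are measured in the bases rotated by $U(g_1),\dots,U(g_n)$ with outcomes $i_1,\dots,i_n$, the gate induced is the operator $G$ for which the enacted operator $\tilde A_{i_1}\cdots\tilde A_{i_n}$ equals $(\ell(2\ell+1))^{-n/2}\,\Gamma^{i_1}\cdots\Gamma^{i_n}\,G$; the factor $\Gamma^{i_1}\cdots\Gamma^{i_n}$ is the byproduct. Then: 1. The Kraus operators satisfy $\sum_{a<b}A_{ab}^\dagger A_{ab}=\mathbb 1$. The matrices $U(g)$ form an irreducible unitary representation of $SO(2\ell+1)$. 2. (Gates.) Every measurement record induces a unitary gate, and the set $\mathcal G$ of all induced gates (over all $n$, all $g_k$ and all outcomes) is a subgroup of $U(2^\ell)$, namely the group generated by the unitaries $e^{-i\theta\Gamma^{ab}}$ ($a\neq b$, $\theta\in\mathbb R$). It acts irreducibly on the virtual space. Modulo global phases it is $SO(2\ell+1)$: there is a homomorphism $\pi:\mathcal G\to SO(2\ell+1)$ that is surjective and a topological quotient map, whose kernel is the set of scalar matrices in $\mathcal G$, which is $\{\pm \mathbb 1\}$, and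 which satisfies the symmetry condition $\sum_j U(\pi(V))_{ij}A_j=V^\dagger A_iV$ for all $V\in\mathcal G$ and all $i$. 3. (Success probability.) Let $a\ne b$ and $\theta\in\mathbb R$ be such that $e^{-i\theta\Gamma^{ab}}$ is not a scalar matrix. Measure one site in the basis rotated by $U(\pi(V))$ with $V=e^{-i\theta\Gamma^{ab}/2}\in\mathcal G$. Then each outcome $i$ enacts either $A_i\,e^{-i\theta\Gamma^{ab}}$ (success) or $A_i$ (the identity gate up to byproduct), and for every unit vector of the virtual space the probability of success is $$p=\frac{2(2\ell-1)}{\ell(2\ell+1)}.$$ The same holds for projections on the virtual space: for all $a\ne b$ there are an orthonormal on-site measurement basis and a set $S$ of outcomes such that each outcome in $S$ enacts, up to a nonzero factor, a Pauli operator (a tensor product of $\mathbb 1,X,Y,Z$ up to a phase in $\{\pm1,\pm i\}$) times one of the projectors $(\mathbb 1\pm\Gamma^{ab})/2$, every outcome $i\notin S$ enacts $A_i$, and for every unit vector of the virtual space the probability of $S$ is $p$. 4. (Byproducts.) The operators $\Gamma_a\Gamma_b$ ($a\ne b$), and all byproducts $\Gamma^{i_1}\cdots\Gamma^{i_n}$,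 are tensor products of Pauli operators $\mathbb 1,X,Y,Z$ up to a phase in $\{\pm1,\pm i\}$. -/

import Mathlib

noncomputable section

namespace AKLT

open Matrix

/-! ### Matrix product states and local measurements -/

/-- The amplitudes `⟨R| A_{i₁} ⋯ A_{iₙ} |L⟩` of the matrix product state with site tensor `A` on
`n` sites, with open boundary vectors `R`, `L` in the virtual space. -/
def mpsState {ι κ : Type} [Fintype κ] [DecidableEq κ] (A : ι → Matrix κ κ ℂ) (n : ℕ)
    (R L : κ → ℂ) : (Fin n → ι) → ℂ :=
  fun i => star R ⬝ᵥ ((List.ofFn fun k => A (i k)).prod *ᵥ L)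

/-- The amplitude of the outcomes `i` when site `k` of the state `Ψ` is measured in the basis
`⟨w_s| = ∑ⱼ (W k)_{sj} ⟨j|`. -/
def measuredAmplitude {ι : Type} [Fintype ι] {n : ℕ} (W : Fin n → Matrix ι ι ℂ)
    (i : Fin n → ι) (Ψ : (Fin n → ι) → ℂ) : ℂ :=
  ∑ j : Fin n → ι, (∏ k, W k (i k) (j k)) * Ψ j

/-- The operator `∑ⱼ w_{ij} A_j` enacted on the virtual space by the outcome `i` of a measurement of
one site in the basis rotated by `W`. -/
def rotatedKraus {ι κ : Type} [Fintype ι] (A : ι → Matrix κ κ ℂ) (W : Matrix ι ι ℂ) (i : ι) :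
    Matrix κ κ ℂ :=
  ∑ j, W i j • A j

/-- The squared Hilbert space norm. -/
def normSq {κ : Type} [Fintype κ] (ψ : κ → ℂ) : ℝ := ∑ x, ‖ψ x‖ ^ 2

open Classical in
/-- The Born probability that the measurement of one site in the basis rotated by `W`, with the
virtual system in the state `ψ`, has an outcome in the event `S`. -/
def eventProb {ι κ : Type} [Fintype ι] [Fintype κ] (A : ι → Matrix κ κ ℂ) (W : Matrix ι ι ℂ)
    (ψ : κ → ℂ) (S : Set ι) : ℝ :=
  ∑ i, if i ∈ S then normSq (rotatedKraus A W i *ᵥ ψ) else 0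

/-- A set of matrices acts irreducibly on `κ → ℂ`: the space is nonzero and the only invariant
subspaces are the trivial ones. -/
def ActsIrreducibly {κ : Type} [Fintype κ] (S : Set (Matrix κ κ ℂ)) : Prop :=
  Nonempty κ ∧ ∀ E : Submodule ℂ (κ → ℂ),
    (∀ M ∈ S, ∀ v ∈ E, M *ᵥ v ∈ E) → E = ⊥ ∨ E = ⊤

/-! ### Pauli operators and Clifford matrices on `ℓ` qubits -/

/-- Basis labels of `ℓ` qubits. -/
abbrev Qubits (ℓ : ℕ) : Type := Fin ℓ → Fin 2

/-- The matrices `𝟙, X, Y, Z`. -/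
def pauli : Fin 4 → Matrix (Fin 2) (Fin 2) ℂ :=
  ![1, !![0, 1; 1, 0], !![0, -Complex.I; Complex.I, 0], !![1, 0; 0, -1]]

/-- The tensor product of one-qubit operators `pauli (s 0) ⊗ pauli (s 1) ⊗ ⋯`. -/
def pauliString {ℓ : ℕ} (s : Fin ℓ → Fin 4) : Matrix (Qubits ℓ) (Qubits ℓ) ℂ :=
  of fun x y => ∏ k, pauli (s k) (x k) (y k)

/-- A tensor product of Pauli operators, up to a phase `1, i, -1, -i`. -/
def IsPauliOp {ℓ : ℕ} (M : Matrix (Qubits ℓ) (Qubits ℓ) ℂ) : Prop :=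
  ∃ (u : ℂ) (s : Fin ℓ → Fin 4), u ^ 4 = 1 ∧ M = u • pauliString s

/-- `P ⊗ M` for an operator `P` on one qubit and `M` on `ℓ` further qubits. -/
def qubitTensor {ℓ : ℕ} (P : Matrix (Fin 2) (Fin 2) ℂ) (M : Matrix (Qubits ℓ) (Qubits ℓ) ℂ) :
    Matrix (Qubits (ℓ + 1)) (Qubits (ℓ + 1)) ℂ :=
  of fun x y => P (x 0) (y 0) * M (Fin.tail x) (Fin.tail y)

/-- The Clifford matrices, indexed from `0`: for `ℓ + 1` qubits they are `X ⊗ Γ'ᵢ` for the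
`2ℓ + 1` Clifford matrices `Γ'ᵢ` on `ℓ` qubits, followed by `Y ⊗ 𝟙` and `Z ⊗ 𝟙`. For one qubit
this gives `X, Y, Z`. -/
def cliffordAux : (ℓ : ℕ) → ℕ → Matrix (Qubits ℓ) (Qubits ℓ) ℂ
  | 0, _ => 1
  | ℓ + 1, i =>
    if i < 2 * ℓ + 1 then qubitTensor (pauli 1) (cliffordAux ℓ i)
    else if i = 2 * ℓ + 1 then qubitTensor (pauli 2) 1
    else qubitTensor (pauli 3) 1

/-- The Clifford matrices `Γ_a`, `a = 0, …, 2ℓ`. -/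
def gamma (ℓ : ℕ) (a : Fin (2 * ℓ + 1)) : Matrix (Qubits ℓ) (Qubits ℓ) ℂ := cliffordAux ℓ a

/-- The generators `Γ^{ab} = -i Γ_a Γ_b` of `so(2ℓ+1)` in the spinor representation
(used for `a ≠ b`). -/
def gammaPair {ℓ : ℕ} (a b : Fin (2 * ℓ + 1)) : Matrix (Qubits ℓ) (Qubits ℓ) ℂ :=
  -Complex.I • (gamma ℓ a * gamma ℓ b)

/-- The unitary `exp(-i θ Γ^{ab})`. -/
def expGate {ℓ : ℕ} (a b : Fin (2 * ℓ + 1)) (θ : ℝ) : Matrix (Qubits ℓ) (Qubits ℓ) ℂ :=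
  NormedSpace.exp ((-Complex.I * (θ : ℂ)) • gammaPair a b)

/-! ### The `SO(2ℓ+1)` AKLT state with on-site adjoint representation -/

/-- The group `SO(2ℓ+1)`. -/
abbrev SO (ℓ : ℕ) : Type := specialOrthogonalGroup (Fin (2 * ℓ + 1)) ℝ

/-- Labels `(a, b)`, `a < b`, of the on-site basis. -/
abbrev Pair (ℓ : ℕ) : Type := {p : Fin (2 * ℓ + 1) × Fin (2 * ℓ + 1) // p.1 < p.2}

/-- The Pauli-type operator `Γ^{ab}` with `a < b`. -/
def pairOp {ℓ : ℕ} (p : Pair ℓ) : Matrix (Qubits ℓ) (Qubits ℓ) ℂ := gammaPair p.1.1 p.1.2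

/-- The adjoint representation of `SO(2ℓ+1)`, i.e. `X ↦ g X gᵀ` on antisymmetric matrices, in the
basis `E_{ab} - E_{ba}`, `a < b`. -/
def adjoint {ℓ : ℕ} (g : SO ℓ) : Matrix (Pair ℓ) (Pair ℓ) ℂ :=
  of fun p q =>
    ((g.1 p.1.1 q.1.1 * g.1 p.1.2 q.1.2 - g.1 p.1.1 q.1.2 * g.1 p.1.2 q.1.1 : ℝ) : ℂ)

/-- The normalization `1 / √(ℓ(2ℓ+1))` of the Kraus operators. -/
def krausNorm (ℓ : ℕ) : ℝ := 1 / Real.sqrt ((ℓ : ℝ) * (2 * ℓ + 1))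

/-- The Kraus operators `Γ^{ab} / √(ℓ(2ℓ+1))`, `a < b`, of the AKLT state. -/
def akltTensor (ℓ : ℕ) (p : Pair ℓ) : Matrix (Qubits ℓ) (Qubits ℓ) ℂ :=
  (krausNorm ℓ : ℂ) • pairOp p

/-- The `SO(2ℓ+1)` AKLT state on `n` sites with open boundary vectors `R`, `L`. -/
def akltState (ℓ n : ℕ) (R L : Qubits ℓ → ℂ) : (Fin n → Pair ℓ) → ℂ :=
  mpsState (akltTensor ℓ) n R L

/-! ### Gates induced by symmetry-rotated measurements -/

/-- The byproduct `Γ^{i₁} ⋯ Γ^{iₙ}` of the outcomes `i₁, …, iₙ`. -/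
def byproduct {ℓ n : ℕ} (i : Fin n → Pair ℓ) : Matrix (Qubits ℓ) (Qubits ℓ) ℂ :=
  (List.ofFn fun k => pairOp (i k)).prod

/-- Measuring site `k` of the AKLT state in the basis rotated by the on-site symmetry operation
`adjoint (g k)`, with outcomes `i`, induces on the virtual space the gate `G` up to the byproduct
of the outcomes: for all boundary vectors the projected state is `⟨R| (byproduct) G |L⟩`, up to the
normalization of the Kraus operators. -/
def Induces {ℓ n : ℕ} (g : Fin n → SO ℓ) (i : Fin n → Pair ℓ)
    (G : Matrix (Qubits ℓ) (Qubits ℓ) ℂ) : Prop :=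
  ∀ R L : Qubits ℓ → ℂ,
    measuredAmplitude (fun k => adjoint (g k)) i (akltState ℓ n R L)
      = (krausNorm ℓ : ℂ) ^ n * (star R ⬝ᵥ ((byproduct i * G) *ᵥ L))

/-- The set of all gates on the virtual space induced by finitely many on-site projective
measurements in symmetry-rotated bases. -/
def inducedGates (ℓ : ℕ) : Set (Matrix (Qubits ℓ) (Qubits ℓ) ℂ) :=
  {G | ∃ (n : ℕ) (g : Fin n → SO ℓ) (i : Fin n → Pair ℓ), Induces g i G}

/-- The claimed success probability. -/
def successProb (ℓ : ℕ) : ℝ := 2 * (2 * (ℓ : ℝ) - 1) / ((ℓ : ℝ) * (2 * ℓ + 1))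

end AKLT

end

noncomputable section

namespace AKLT

open Matrix

/-! ### Tensor products with one qubit -/

section QubitTensor

variable {ℓ : ℕ}

/-! For a ≠ b the product Γ_aΓ_b squares to -1, anticommutes with Γ_a and Γ_b, and commutes with the
other Γ_c. Hence conjugation by V = exp(-iθΓ^{ab}/2) rotates the Clifford matrices by θ in the plane
(a, b) (`implements_expGate`) and the operators Γ^{mn} by the adjoint matrix of that rotation
(`Implements.conj_pairOp`), so a symmetry-rotated measurement enacts V†A_iV. This is A_iV² when
exactly one of m, n lies in {a, b} (`Crosses`), and A_i otherwise. There are 2(2ℓ-1) crossing pairs;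
a non-crossing outcome keeps its probability 1/(ℓ(2ℓ+1)), and since a unitary change of basis
preserves the total, the rest is the success probability (`eventProb_crosses`). For projections, a
crossing pair p is superposed with its partner p' under a ↔ b, because Γ^{p'} = ±iΓ^pΓ^{ab}.

Induced gates: Γ^p is i times an elementary gate, so the enacted operator and the byproduct are
elements of the generated group times the same phase i^n, and the gate lies in the group
(`exists_mem_spinGroup_induces`). Conversely, moving an elementary gate through a byproduct at most
changes the sign of its angle, which can be chosen in advance, so every word in the generators is
induced (`mem_inducedGates_of_mem_spinGroup`).

Covering map: it is onto because plane rotations generate SO(2ℓ+1) (`mem_of_planeRot_mem`). Its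
kernel commutes with all Γ_aΓ_b, which generate the full matrix algebra (`adjoin_gamma_mul_gamma`),
so it is scalar; the group also preserves a charge conjugation form, VCVᵀ = C, which leaves ±1.
These two properties characterize the group by closed conditions (`mem_spinGroup_iff`), so it is
compact and the covering is a quotient map. -/

lemma qubitTensor_mul (P Q : Matrix (Fin 2) (Fin 2) ℂ) (M N : Matrix (Qubits ℓ) (Qubits ℓ) ℂ) :
    qubitTensor P M * qubitTensor Q N = qubitTensor (P * Q) (M * N) := by
  ext x y
  simp only [qubitTensor, mul_apply, of_apply]
  rw [← (Fin.consEquiv (fun _ : Fin (ℓ + 1) => Fin 2)).sum_comp, Fintype.sum_prod_type,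
    Finset.sum_mul_sum]
  refine Finset.sum_congr rfl fun i _ => Finset.sum_congr rfl fun j _ => ?_
  simp only [Fin.consEquiv, Equiv.coe_fn_mk, Fin.cons_zero, Fin.tail_cons]
  ring

lemma qubitTensor_one : qubitTensor (1 : Matrix (Fin 2) (Fin 2) ℂ)
    (1 : Matrix (Qubits ℓ) (Qubits ℓ) ℂ) = 1 := by
  ext x y
  simp only [qubitTensor, one_apply, of_apply]
  have h : x = y ↔ x 0 = y 0 ∧ Fin.tail x = Fin.tail y := by
    constructor
    · rintro rfl; exact ⟨rfl, rfl⟩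
    · rintro ⟨h0, h1⟩
      rw [← Fin.cons_self_tail x, ← Fin.cons_self_tail y, h0, h1]
  by_cases h0 : x 0 = y 0 <;> by_cases h1 : Fin.tail x = Fin.tail y <;> simp [h, h0, h1]

lemma qubitTensor_conjTranspose (P : Matrix (Fin 2) (Fin 2) ℂ)
    (M : Matrix (Qubits ℓ) (Qubits ℓ) ℂ) : (qubitTensor P M)ᴴ = qubitTensor Pᴴ Mᴴ := by
  ext x y; simp [qubitTensor]

lemma qubitTensor_transpose (P : Matrix (Fin 2) (Fin 2) ℂ)
    (M : Matrix (Qubits ℓ) (Qubits ℓ) ℂ) : (qubitTensor P M)ᵀ = qubitTensor Pᵀ Mᵀ := by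
  ext x y; simp [qubitTensor]

lemma qubitTensor_smul_left (c : ℂ) (P : Matrix (Fin 2) (Fin 2) ℂ)
    (M : Matrix (Qubits ℓ) (Qubits ℓ) ℂ) : qubitTensor (c • P) M = c • qubitTensor P M := by
  ext x y; simp [qubitTensor, mul_assoc]

lemma qubitTensor_smul_right (c : ℂ) (P : Matrix (Fin 2) (Fin 2) ℂ)
    (M : Matrix (Qubits ℓ) (Qubits ℓ) ℂ) : qubitTensor P (c • M) = c • qubitTensor P M := by
  ext x y; simp [qubitTensor, mul_left_comm]

lemma qubitTensor_neg_left (P : Matrix (Fin 2) (Fin 2) ℂ)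
    (M : Matrix (Qubits ℓ) (Qubits ℓ) ℂ) : qubitTensor (-P) M = -qubitTensor P M := by
  ext x y; simp [qubitTensor]

lemma qubitTensor_neg_right (P : Matrix (Fin 2) (Fin 2) ℂ)
    (M : Matrix (Qubits ℓ) (Qubits ℓ) ℂ) : qubitTensor P (-M) = -qubitTensor P M := by
  ext x y; simp [qubitTensor]

lemma qubitTensor_add_left (P Q : Matrix (Fin 2) (Fin 2) ℂ)
    (M : Matrix (Qubits ℓ) (Qubits ℓ) ℂ) :
    qubitTensor (P + Q) M = qubitTensor P M + qubitTensor Q M := by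
  ext x y; simp [qubitTensor, add_mul]

lemma qubitTensor_add_right (P : Matrix (Fin 2) (Fin 2) ℂ)
    (M N : Matrix (Qubits ℓ) (Qubits ℓ) ℂ) :
    qubitTensor P (M + N) = qubitTensor P M + qubitTensor P N := by
  ext x y; simp [qubitTensor, mul_add]

lemma qubitTensor_single (i j : Fin 2) (x y : Qubits ℓ) :
    qubitTensor (single i j (1 : ℂ)) (single x y (1 : ℂ))
      = single (Fin.cons i x : Qubits (ℓ + 1)) (Fin.cons j y : Qubits (ℓ + 1)) 1 := by
  ext u v
  have h : ∀ (i : Fin 2) (x : Qubits ℓ) (u : Qubits (ℓ + 1)),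
      (Fin.cons i x : Qubits (ℓ + 1)) = u ↔ i = u 0 ∧ x = Fin.tail u := by
    intro i x u
    rw [← Fin.cons_self_tail u, Fin.cons_inj]; simp
  simp only [qubitTensor, single, of_apply, h]
  by_cases h1 : i = u 0 <;> by_cases h2 : j = v 0 <;> by_cases h3 : x = Fin.tail u <;>
    by_cases h4 : y = Fin.tail v <;> simp [h1, h2, h3, h4]

end QubitTensor

/-! ### Pauli operators -/

lemma pauli_mul (i j : Fin 4) : ∃ (u : ℂ) (k : Fin 4), u ^ 4 = 1 ∧
    pauli i * pauli j = u • pauli k := by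
  have hI : Complex.I ^ 4 = 1 := Complex.I_pow_four
  have hI' : (-Complex.I) ^ 4 = 1 := by rw [neg_pow, hI]; norm_num
  have key : ∃ (u : ℂ) (k : Fin 4), (u = 1 ∨ u = Complex.I ∨ u = -Complex.I) ∧
      pauli i * pauli j = u • pauli k := by
    fin_cases i <;> fin_cases j
    · exact ⟨1, 0, .inl rfl, by simp [pauli]⟩
    · exact ⟨1, 1, .inl rfl, by simp [pauli]⟩
    · exact ⟨1, 2, .inl rfl, by simp [pauli]⟩
    · exact ⟨1, 3, .inl rfl, by simp [pauli]⟩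
    · exact ⟨1, 1, .inl rfl, by simp [pauli]⟩
    · exact ⟨1, 0, .inl rfl, by simp [pauli, Matrix.one_fin_two]⟩
    · exact ⟨Complex.I, 3, .inr (.inl rfl), by simp [pauli]⟩
    · exact ⟨-Complex.I, 2, .inr (.inr rfl), by simp [pauli]⟩
    · exact ⟨1, 2, .inl rfl, by simp [pauli]⟩
    · exact ⟨-Complex.I, 3, .inr (.inr rfl), by simp [pauli]⟩
    · exact ⟨1, 0, .inl rfl, by simp [pauli, Matrix.one_fin_two]⟩
    · exact ⟨Complex.I, 1, .inr (.inl rfl), by simp [pauli]⟩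
    · exact ⟨1, 3, .inl rfl, by simp [pauli]⟩
    · exact ⟨Complex.I, 2, .inr (.inl rfl), by simp [pauli]⟩
    · exact ⟨-Complex.I, 1, .inr (.inr rfl), by simp [pauli]⟩
    · exact ⟨1, 0, .inl rfl, by simp [pauli, Matrix.one_fin_two]⟩
  obtain ⟨u, k, hu, h⟩ := key
  refine ⟨u, k, ?_, h⟩
  rcases hu with rfl | rfl | rfl
  · norm_num
  · exact hI
  · exact hI'

lemma pauli_mul_self (i : Fin 4) : pauli i * pauli i = 1 := by
  fin_cases i <;> simp [pauli, Matrix.one_fin_two]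

lemma pauli_conjTranspose (i : Fin 4) : (pauli i)ᴴ = pauli i := by
  fin_cases i <;> ext x y <;> fin_cases x <;> fin_cases y <;> simp [pauli]

lemma pauli_anticomm {i j : Fin 4} (hi : i ≠ 0) (hj : j ≠ 0) (hij : i ≠ j) :
    pauli i * pauli j = -(pauli j * pauli i) := by
  fin_cases i <;> fin_cases j <;> simp_all [pauli]

/-- The matrix product is computed qubit by qubit: the sum over intermediate basis labels factors
over the qubits, and the one-qubit phases multiply. -/
lemma pauliString_mul {ℓ : ℕ} (s t : Fin ℓ → Fin 4) :
    IsPauliOp (pauliString s * pauliString t) := by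
  choose u k hu h using fun i => pauli_mul (s i) (t i)
  refine ⟨∏ i, u i, k, by rw [← Finset.prod_pow]; simp [hu], ?_⟩
  ext x y
  simp only [pauliString, mul_apply, of_apply, Matrix.smul_apply, smul_eq_mul,
    ← Finset.prod_mul_distrib]
  rw [← Fintype.prod_sum fun i (z : Fin 2) => pauli (s i) (x i) z * pauli (t i) z (y i)]
  refine Finset.prod_congr rfl fun i _ => ?_
  have := congrFun (congrFun (h i) (x i)) (y i)
  simpa [mul_apply] using this

lemma IsPauliOp.mul {ℓ : ℕ} {M N : Matrix (Qubits ℓ) (Qubits ℓ) ℂ} (hM : IsPauliOp M)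
    (hN : IsPauliOp N) : IsPauliOp (M * N) := by
  obtain ⟨u, s, hu, rfl⟩ := hM
  obtain ⟨v, t, hv, rfl⟩ := hN
  obtain ⟨w, r, hw, h⟩ := pauliString_mul s t
  refine ⟨u * v * w, r, by rw [mul_pow, mul_pow, hu, hv, hw]; norm_num, ?_⟩
  rw [smul_mul_smul_comm, h, smul_smul]

lemma IsPauliOp.smul {ℓ : ℕ} {M : Matrix (Qubits ℓ) (Qubits ℓ) ℂ} (hM : IsPauliOp M) {c : ℂ}
    (hc : c ^ 4 = 1) : IsPauliOp (c • M) := by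
  obtain ⟨u, s, hu, rfl⟩ := hM
  exact ⟨c * u, s, by rw [mul_pow, hu, hc, one_mul], smul_smul _ _ _⟩

lemma isPauliOp_one (ℓ : ℕ) : IsPauliOp (1 : Matrix (Qubits ℓ) (Qubits ℓ) ℂ) := by
  refine ⟨1, fun _ => 0, by norm_num, ?_⟩
  ext x y
  simp only [pauliString, pauli, one_smul, of_apply, one_apply, Matrix.cons_val_zero,
    Finset.prod_ite_zero, Finset.prod_const_one, funext_iff, Finset.mem_univ, true_imp_iff]

lemma IsPauliOp.qubitTensor {ℓ : ℕ} {M : Matrix (Qubits ℓ) (Qubits ℓ) ℂ} (hM : IsPauliOp M)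
    (i : Fin 4) : IsPauliOp (qubitTensor (pauli i) M) := by
  obtain ⟨u, s, hu, rfl⟩ := hM
  refine ⟨u, Fin.cons i s, hu, ?_⟩
  rw [qubitTensor_smul_right]
  congr 1
  ext x y
  simp [AKLT.qubitTensor, pauliString, Fin.prod_univ_succ, Fin.tail]

/-! ### Clifford relations -/

lemma cliffordAux_mul_self (ℓ i : ℕ) : cliffordAux ℓ i * cliffordAux ℓ i = 1 := by
  induction ℓ generalizing i with
  | zero => simp [cliffordAux]
  | succ ℓ ih =>
    simp only [cliffordAux]
    split_ifs <;> simp [qubitTensor_mul, pauli_mul_self, ih, qubitTensor_one]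

lemma cliffordAux_conjTranspose (ℓ i : ℕ) : (cliffordAux ℓ i)ᴴ = cliffordAux ℓ i := by
  induction ℓ generalizing i with
  | zero => simp [cliffordAux]
  | succ ℓ ih =>
    simp only [cliffordAux]
    split_ifs <;> simp [qubitTensor_conjTranspose, pauli_conjTranspose, ih]

/-- The bounds matter: on at least one qubit, all indices past the last one give the same matrix Z ⊗
𝟙. -/
lemma cliffordAux_anticomm (ℓ : ℕ) {i j : ℕ} (hi : i < 2 * ℓ + 1) (hj : j < 2 * ℓ + 1)
    (hij : i ≠ j) : cliffordAux ℓ i * cliffordAux ℓ j = -(cliffordAux ℓ j * cliffordAux ℓ i) := by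
  induction ℓ generalizing i j with
  | zero => omega
  | succ ℓ ih =>
    have h12 := pauli_anticomm (i := 1) (j := 2) (by decide) (by decide) (by decide)
    have h13 := pauli_anticomm (i := 1) (j := 3) (by decide) (by decide) (by decide)
    have h23 := pauli_anticomm (i := 2) (j := 3) (by decide) (by decide) (by decide)
    simp only [cliffordAux]
    split_ifs with h1 h2 h2 h3 h4 h4 h5 h6 <;>
      first
      | omega
      | rw [qubitTensor_mul, qubitTensor_mul, ih h1 h2 hij, qubitTensor_neg_right]
      | simp only [qubitTensor_mul, mul_one, one_mul, h12, h13, h23, qubitTensor_neg_left, neg_neg]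

lemma isPauliOp_cliffordAux (ℓ i : ℕ) : IsPauliOp (cliffordAux ℓ i) := by
  induction ℓ generalizing i with
  | zero => exact isPauliOp_one 0
  | succ ℓ ih =>
    simp only [cliffordAux]
    split_ifs
    · exact (ih i).qubitTensor 1
    · exact (isPauliOp_one ℓ).qubitTensor 2
    · exact (isPauliOp_one ℓ).qubitTensor 3

section Gamma

variable {ℓ : ℕ} (a b : Fin (2 * ℓ + 1))

lemma gamma_mul_self : gamma ℓ a * gamma ℓ a = 1 := cliffordAux_mul_self ℓ a

lemma gamma_conjTranspose : (gamma ℓ a)ᴴ = gamma ℓ a := cliffordAux_conjTranspose ℓ a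

variable {a b} in
lemma gamma_anticomm (hab : a ≠ b) : gamma ℓ a * gamma ℓ b = -(gamma ℓ b * gamma ℓ a) :=
  cliffordAux_anticomm ℓ a.2 b.2 fun h => hab (Fin.ext h)

lemma isPauliOp_gamma : IsPauliOp (gamma ℓ a) := isPauliOp_cliffordAux ℓ a

lemma isPauliOp_pairOp (p : Pair ℓ) : IsPauliOp (pairOp p) := by
  refine ((isPauliOp_gamma _).mul (isPauliOp_gamma _)).smul ?_
  rw [neg_pow, Complex.I_pow_four]; norm_num

lemma isPauliOp_byproduct {n : ℕ} (i : Fin n → Pair ℓ) : IsPauliOp (byproduct i) := by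
  induction n with
  | zero => simpa [byproduct] using isPauliOp_one ℓ
  | succ n ih =>
    simp only [byproduct, List.ofFn_succ, List.prod_cons] at ih ⊢
    exact (isPauliOp_pairOp _).mul (ih _)

end Gamma

/-! ### Charge conjugation -/

/-- The sign must alternate, so the factor of `C` on the new qubit has to anticommute with X. Y does
this for even `ℓ` and Z for odd `ℓ`; the choice is dictated by Yᵀ = -Y together with Zᵀ = Z. `D` is
an inverse, recorded to see that `C` is nonzero. -/
lemma exists_charge_conjugation_aux (ℓ : ℕ) :
    ∃ C D : Matrix (Qubits ℓ) (Qubits ℓ) ℂ, C * D = 1 ∧ ∀ i < 2 * ℓ + 1,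
      C * (cliffordAux ℓ i)ᵀ = (-1 : ℂ) ^ ℓ • (cliffordAux ℓ i * C) := by
  have t1 : (pauli 1)ᵀ = pauli 1 := by
    ext x y; fin_cases x <;> fin_cases y <;> simp [pauli]
  have t2 : (pauli 2)ᵀ = -pauli 2 := by
    ext x y; fin_cases x <;> fin_cases y <;> simp [pauli]
  have t3 : (pauli 3)ᵀ = pauli 3 := by
    ext x y; fin_cases x <;> fin_cases y <;> simp [pauli]
  have h12 := pauli_anticomm (i := 1) (j := 2) (by decide) (by decide) (by decide)
  have h13 := pauli_anticomm (i := 1) (j := 3) (by decide) (by decide) (by decide)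
  have h23 := pauli_anticomm (i := 2) (j := 3) (by decide) (by decide) (by decide)
  induction ℓ with
  | zero => exact ⟨1, 1, by simp, fun i _ => by simp [cliffordAux]⟩
  | succ ℓ ih =>
    obtain ⟨C, D, hCD, hC⟩ := ih
    rcases Nat.even_or_odd ℓ with hℓ | hℓ
    · refine ⟨qubitTensor (pauli 2) C, qubitTensor (pauli 2) D,
        by rw [qubitTensor_mul, pauli_mul_self, hCD, qubitTensor_one], fun i _ => ?_⟩
      rw [hℓ.neg_one_pow] at hC
      rw [hℓ.add_one.neg_one_pow]
      simp only [cliffordAux]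
      split_ifs with h1 h2
      · rw [qubitTensor_transpose, qubitTensor_mul, qubitTensor_mul, hC i h1, t1, h12]
        simp [qubitTensor_neg_left]
      · rw [qubitTensor_transpose, qubitTensor_mul, qubitTensor_mul, t2]
        simp [qubitTensor_neg_left]
      · rw [qubitTensor_transpose, qubitTensor_mul, qubitTensor_mul, t3, h23]
        simp [qubitTensor_neg_left]
    · refine ⟨qubitTensor (pauli 3) C, qubitTensor (pauli 3) D,
        by rw [qubitTensor_mul, pauli_mul_self, hCD, qubitTensor_one], fun i _ => ?_⟩
      rw [hℓ.neg_one_pow] at hC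
      rw [hℓ.add_one.neg_one_pow]
      simp only [cliffordAux]
      split_ifs with h1 h2
      · rw [qubitTensor_transpose, qubitTensor_mul, qubitTensor_mul, hC i h1, t1, h13]
        simp [qubitTensor_neg_left, qubitTensor_neg_right]
      · rw [qubitTensor_transpose, qubitTensor_mul, qubitTensor_mul, t2, h23]
        simp
      · rw [qubitTensor_transpose, qubitTensor_mul, qubitTensor_mul, t3]
        simp

/-- On even products the two signs (-1)^ℓ cancel. The resulting form is invariant under the gate
group and cuts its scalars down to ±1. -/
lemma exists_charge_conjugation (ℓ : ℕ) :
    ∃ C : Matrix (Qubits ℓ) (Qubits ℓ) ℂ, C ≠ 0 ∧ ∀ a b,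
      C * (gamma ℓ a * gamma ℓ b)ᵀ = gamma ℓ b * gamma ℓ a * C := by
  obtain ⟨C, D, hCD, hC⟩ := exists_charge_conjugation_aux ℓ
  refine ⟨C, ?_, fun a b => ?_⟩
  · rintro rfl
    rw [zero_mul] at hCD
    exact zero_ne_one hCD
  · rw [transpose_mul, ← mul_assoc, gamma, hC b b.2, smul_mul_assoc, mul_assoc, gamma, hC a a.2,
      mul_smul_comm, smul_smul, ← mul_pow, ← mul_assoc]
    simp

/-! ### The even Clifford algebra is the full matrix algebra -/

lemma mem_of_pauli_mem {B : Submodule ℂ (Matrix (Fin 2) (Fin 2) ℂ)} (h : ∀ i, pauli i ∈ B)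
    (P : Matrix (Fin 2) (Fin 2) ℂ) : P ∈ B := by
  -- The coefficients are the half traces Tr(σP)/2 against the Pauli matrices σ.
  have : P = ((P 0 0 + P 1 1) / 2) • pauli 0 + ((P 0 1 + P 1 0) / 2) • pauli 1
      + (Complex.I * (P 0 1 - P 1 0) / 2) • pauli 2 + ((P 0 0 - P 1 1) / 2) • pauli 3 := by
    ext x y
    fin_cases x <;> fin_cases y <;> simp [pauli] <;> ring_nf <;> simp <;> ring
  rw [this]
  exact B.add_mem (B.add_mem (B.add_mem (B.smul_mem _ (h 0)) (B.smul_mem _ (h 1)))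
    (B.smul_mem _ (h 2))) (B.smul_mem _ (h 3))

/-- Induction on the number of qubits: since X² = 1, even products of the old matrices appear as 𝟙 ⊗
M, which gives all of 𝟙 ⊗ M. It remains to obtain X, Y, Z on the new qubit. -/
lemma adjoin_cliffordAux (ℓ : ℕ) : Algebra.adjoin ℂ {M | ∃ i < 2 * ℓ + 1, ∃ j < 2 * ℓ + 1, i ≠ j ∧
    M = cliffordAux ℓ i * cliffordAux ℓ j} = ⊤ := by
  induction ℓ with
  | zero =>
    refine eq_top_iff.2 fun M _ => ?_
    have : M = algebraMap ℂ _ (M default default) := by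
      ext x y
      rw [Subsingleton.elim x default, Subsingleton.elim y default]
      simp [Matrix.algebraMap_matrix_apply]
    rw [this]
    exact Subalgebra.algebraMap_mem _ _
  | succ ℓ ih =>
    set A := Algebra.adjoin ℂ {M | ∃ i < 2 * (ℓ + 1) + 1, ∃ j < 2 * (ℓ + 1) + 1, i ≠ j ∧
      M = cliffordAux (ℓ + 1) i * cliffordAux (ℓ + 1) j} with hA
    have hgen : ∀ i < 2 * (ℓ + 1) + 1, ∀ j < 2 * (ℓ + 1) + 1, i ≠ j →
        cliffordAux (ℓ + 1) i * cliffordAux (ℓ + 1) j ∈ A := fun i hi j hj hij =>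
      Algebra.subset_adjoin ⟨i, hi, j, hj, hij, rfl⟩
    have hXX : pauli 1 * pauli 1 = 1 := pauli_mul_self 1
    have hright : ∀ M : Matrix (Qubits ℓ) (Qubits ℓ) ℂ, qubitTensor 1 M ∈ A := by
      intro M
      have hM : M ∈ Algebra.adjoin ℂ {M | ∃ i < 2 * ℓ + 1, ∃ j < 2 * ℓ + 1, i ≠ j ∧
        M = cliffordAux ℓ i * cliffordAux ℓ j} := ih ▸ Algebra.mem_top
      induction hM using Algebra.adjoin_induction with
      | mem M hM =>
        obtain ⟨i, hi, j, hj, hij, rfl⟩ := hM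
        have := hgen i (by omega) j (by omega) hij
        simpa only [cliffordAux, hi, hj, if_true, qubitTensor_mul, hXX] using this
      | algebraMap r =>
        rw [Algebra.algebraMap_eq_smul_one, qubitTensor_smul_right, qubitTensor_one]
        exact A.smul_mem A.one_mem r
      | add x y _ _ hx hy =>
        rw [qubitTensor_add_right]; exact A.add_mem hx hy
      | mul x y _ _ hx hy =>
        rw [← one_mul (1 : Matrix (Fin 2) (Fin 2) ℂ), ← qubitTensor_mul]; exact A.mul_mem hx hy
    have hX : qubitTensor (pauli 1) (1 : Matrix (Qubits ℓ) (Qubits ℓ) ℂ) ∈ A := by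
      have := hgen (2 * ℓ + 1) (by omega) (2 * ℓ + 2) (by omega) (by omega)
      -- The product of the last two generators, (Y ⊗ 𝟙)(Z ⊗ 𝟙), is iX ⊗ 𝟙.
      have e : pauli 2 * pauli 3 = Complex.I • pauli 1 := by simp [pauli]
      rw [cliffordAux, cliffordAux, if_neg (by omega), if_pos rfl, if_neg (by omega),
        if_neg (by omega), qubitTensor_mul, one_mul, e, qubitTensor_smul_left] at this
      simpa [smul_smul] using A.smul_mem this (-Complex.I)
    have hY : qubitTensor (pauli 2) (1 : Matrix (Qubits ℓ) (Qubits ℓ) ℂ) ∈ A := by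
      have := hgen 0 (by omega) (2 * ℓ + 1) (by omega) (by omega)
      rw [cliffordAux, cliffordAux, if_pos (by omega), if_neg (by omega), if_pos rfl] at this
      -- From XY ⊗ Γ'₀ the factors X and Γ'₀ are stripped, both now being available separately.
      have h2 := A.mul_mem (hright (cliffordAux ℓ 0)) (A.mul_mem hX this)
      simpa only [qubitTensor_mul, ← mul_assoc, one_mul, mul_one, hXX, cliffordAux_mul_self]
        using h2
    have hZ : qubitTensor (pauli 3) (1 : Matrix (Qubits ℓ) (Qubits ℓ) ℂ) ∈ A := by
      have h2 := A.smul_mem (A.mul_mem hX hY) (-Complex.I)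
      have e : pauli 1 * pauli 2 = Complex.I • pauli 3 := by simp [pauli]
      rw [qubitTensor_mul, e, qubitTensor_smul_left, one_mul, smul_smul] at h2
      simpa using h2
    have hleft : ∀ P, qubitTensor P (1 : Matrix (Qubits ℓ) (Qubits ℓ) ℂ) ∈ A := by
      intro P
      let B : Submodule ℂ (Matrix (Fin 2) (Fin 2) ℂ) :=
        { carrier := {P | qubitTensor P (1 : Matrix (Qubits ℓ) (Qubits ℓ) ℂ) ∈ A}
          add_mem' := fun {x y} hx hy => by
            simp only [Set.mem_ofPred_eq, qubitTensor_add_left] at *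
            exact A.add_mem hx hy
          zero_mem' := by
            have : qubitTensor (0 : Matrix (Fin 2) (Fin 2) ℂ)
                (1 : Matrix (Qubits ℓ) (Qubits ℓ) ℂ) = 0 := by
              ext; simp [qubitTensor]
            simp only [Set.mem_ofPred_eq, this]
            exact A.zero_mem
          smul_mem' := fun c x hx => by
            simp only [Set.mem_ofPred_eq, qubitTensor_smul_left] at *
            exact A.smul_mem hx c }
      refine mem_of_pauli_mem (B := B) (fun i => ?_) P
      fin_cases i
      · exact hright 1
      · exact hX
      · exact hY
      · exact hZ
    refine eq_top_iff.2 fun M _ => ?_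
    rw [matrix_eq_sum_single M]
    refine A.sum_mem fun x _ => A.sum_mem fun y _ => ?_
    have e : single x y (M x y) = M x y • (qubitTensor (single (x 0) (y 0) 1) 1 *
        qubitTensor 1 (single (Fin.tail x) (Fin.tail y) 1)) := by
      rw [qubitTensor_mul, mul_one, one_mul, qubitTensor_single]
      simp [smul_single]
    rw [e]
    exact A.smul_mem (A.mul_mem (hleft _) (hright _)) _

lemma adjoin_gamma_mul_gamma (ℓ : ℕ) :
    Algebra.adjoin ℂ {M | ∃ a b, a ≠ b ∧ M = gamma ℓ a * gamma ℓ b} = ⊤ := by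
  rw [← adjoin_cliffordAux ℓ]
  congr 1
  ext M
  constructor
  · rintro ⟨a, b, hab, rfl⟩
    exact ⟨a, a.2, b, b.2, fun h => hab (Fin.ext h), rfl⟩
  · rintro ⟨i, hi, j, hj, hij, rfl⟩
    exact ⟨⟨i, hi⟩, ⟨j, hj⟩, fun h => hij (congrArg Fin.val h), rfl⟩

lemma eq_smul_one_of_commute {ℓ : ℕ} {V : Matrix (Qubits ℓ) (Qubits ℓ) ℂ}
    (h : ∀ a b, a ≠ b → Commute V (gamma ℓ a * gamma ℓ b)) :
    ∃ c : ℂ, V = c • (1 : Matrix (Qubits ℓ) (Qubits ℓ) ℂ) := by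
  have hV : ∀ M, M * V = V * M := by
    intro M
    have hM : M ∈ Algebra.adjoin ℂ {M | ∃ a b, a ≠ b ∧ M = gamma ℓ a * gamma ℓ b} :=
      adjoin_gamma_mul_gamma ℓ ▸ Algebra.mem_top
    have hle : Algebra.adjoin ℂ {M | ∃ a b, a ≠ b ∧ M = gamma ℓ a * gamma ℓ b}
        ≤ Subalgebra.centralizer ℂ {V} := by
      refine Algebra.adjoin_le ?_
      rintro _ ⟨a, b, hab, rfl⟩
      rw [SetLike.mem_coe, Subalgebra.mem_centralizer_iff]
      rintro _ rfl
      exact h a b hab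
    exact ((Subalgebra.mem_centralizer_iff ℂ).1 (hle hM) V rfl).symm
  have hc : V ∈ Set.center (Matrix (Qubits ℓ) (Qubits ℓ) ℂ) :=
    Semigroup.mem_center_iff.2 hV
  rw [Matrix.center_eq_range ℂ] at hc
  obtain ⟨c, rfl⟩ := hc
  exact ⟨c, by ext; simp [Matrix.one_apply, Matrix.diagonal_apply]⟩

lemma actsIrreducibly_of_gamma_mul_gamma {ℓ : ℕ} {S : Set (Matrix (Qubits ℓ) (Qubits ℓ) ℂ)}
    (hS : ∀ a b, a ≠ b → gamma ℓ a * gamma ℓ b ∈ S) : ActsIrreducibly S := by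
  refine ⟨inferInstance, fun E hE => ?_⟩
  have hall : ∀ M : Matrix (Qubits ℓ) (Qubits ℓ) ℂ, ∀ v ∈ E, M *ᵥ v ∈ E := by
    intro M
    have hM : M ∈ Algebra.adjoin ℂ {M | ∃ a b, a ≠ b ∧ M = gamma ℓ a * gamma ℓ b} :=
      adjoin_gamma_mul_gamma ℓ ▸ Algebra.mem_top
    induction hM using Algebra.adjoin_induction with
    | mem M hM =>
      obtain ⟨a, b, hab, rfl⟩ := hM
      exact hE _ (hS a b hab)
    | algebraMap r =>
      intro v hv
      rw [Algebra.algebraMap_eq_smul_one, smul_mulVec, one_mulVec]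
      exact E.smul_mem r hv
    | add x y _ _ hx hy =>
      intro v hv
      rw [add_mulVec]; exact E.add_mem (hx v hv) (hy v hv)
    | mul x y _ _ hx hy =>
      intro v hv
      rw [← mulVec_mulVec]; exact hx _ (hy v hv)
  by_cases hbot : E = ⊥
  · exact .inl hbot
  obtain ⟨v, hv, hv0⟩ := E.ne_bot_iff.1 hbot
  obtain ⟨x, hx⟩ := Function.ne_iff.1 hv0
  refine .inr (eq_top_iff.2 fun w _ => ?_)
  -- The rank-one matrix that sends `v` to `w`.
  have := hall (of fun i j => if j = x then w i / v x else 0) v hv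
  convert this using 1
  ext i
  simp only [mulVec, dotProduct, of_apply, ite_mul, zero_mul, Finset.sum_ite_eq', Finset.mem_univ,
    if_true]
  exact (div_mul_cancel₀ _ hx).symm

/-! ### Rotations of the Clifford matrices -/

section Rotations

variable {ℓ : ℕ}

lemma gamma_mul_add_gamma_mul (a b : Fin (2 * ℓ + 1)) :
    gamma ℓ a * gamma ℓ b + gamma ℓ b * gamma ℓ a = (if a = b then (2 : ℂ) else 0) • 1 := by
  split_ifs with h
  · subst h; rw [gamma_mul_self, two_smul]
  · rw [gamma_anticomm h, neg_add_cancel, zero_smul]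

variable {a b : Fin (2 * ℓ + 1)}

lemma gamma_mul_gamma_sq (hab : a ≠ b) :
    gamma ℓ a * gamma ℓ b * (gamma ℓ a * gamma ℓ b) = -1 := by
  nth_rewrite 1 [gamma_anticomm hab]
  rw [neg_mul, mul_assoc, ← mul_assoc (gamma ℓ a), gamma_mul_self, one_mul, gamma_mul_self]

lemma gamma_mul_gamma_conjTranspose (hab : a ≠ b) :
    (gamma ℓ a * gamma ℓ b)ᴴ = -(gamma ℓ a * gamma ℓ b) := by
  rw [conjTranspose_mul, gamma_conjTranspose, gamma_conjTranspose, gamma_anticomm hab, neg_neg]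

lemma gamma_mul_gamma_symm (hab : a ≠ b) : gamma ℓ b * gamma ℓ a = -(gamma ℓ a * gamma ℓ b) :=
  gamma_anticomm hab.symm

/-- The real algebra homomorphism ℂ → matrices with i ↦ J is continuous, so it carries Euler's
formula for exp(it) to exp(tJ). The norm is auxiliary. -/
lemma exp_smul_of_mul_self_eq_neg_one {n : Type} [Fintype n] [DecidableEq n] {J : Matrix n n ℂ}
    (hJ : J * J = -1) (t : ℝ) : NormedSpace.exp ((t : ℂ) • J)
      = (Real.cos t : ℂ) • (1 : Matrix n n ℂ) + (Real.sin t : ℂ) • J := by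
  let _ : NormedRing (Matrix n n ℂ) := Matrix.linftyOpNormedRing
  let _ : NormedAlgebra ℂ (Matrix n n ℂ) := Matrix.linftyOpNormedAlgebra
  let f : ℂ →ₐ[ℝ] Matrix n n ℂ := Complex.liftAux J hJ
  have hf : ∀ z : ℂ, f z = (z.re : ℂ) • (1 : Matrix n n ℂ) + (z.im : ℂ) • J := by
    intro z
    have h := Complex.liftAux_apply J hJ z
    rw [Algebra.algebraMap_eq_smul_one] at h
    refine h.trans ?_
    ext i j
    simp
  have hcont : Continuous f := by
    have := f.toLinearMap.continuous_of_finiteDimensional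
    exact this
  have := NormedSpace.map_exp f hcont ((t : ℂ) * Complex.I)
  rw [hf ((t : ℂ) * Complex.I), ← Complex.exp_eq_exp_ℂ, hf] at this
  simp only [Complex.exp_ofReal_mul_I_re, Complex.exp_ofReal_mul_I_im, Complex.re_ofReal_mul,
    Complex.im_ofReal_mul, Complex.I_re, Complex.I_im, mul_zero, mul_one, Complex.ofReal_zero,
    zero_smul, zero_add] at this
  exact this.symm

lemma expGate_eq (hab : a ≠ b) (θ : ℝ) : expGate a b θ
    = (Real.cos θ : ℂ) • (1 : Matrix (Qubits ℓ) (Qubits ℓ) ℂ)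
      - (Real.sin θ : ℂ) • (gamma ℓ a * gamma ℓ b) := by
  have h := exp_smul_of_mul_self_eq_neg_one (gamma_mul_gamma_sq hab) (-θ)
  rw [expGate, gammaPair, smul_smul]
  have e : -Complex.I * (θ : ℂ) * -Complex.I = ((-θ : ℝ) : ℂ) := by
    push_cast
    linear_combination (θ : ℂ) * Complex.I_mul_I
  rw [e, h, Real.cos_neg, Real.sin_neg]
  simp [sub_eq_add_neg]

lemma expGate_mul (hab : a ≠ b) (θ η : ℝ) :
    expGate a b θ * expGate a b η = expGate a b (θ + η) := by
  simp only [expGate_eq hab, Real.cos_add, Real.sin_add, sub_mul, mul_sub, smul_mul_assoc,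
    mul_smul_comm, one_mul, mul_one, gamma_mul_gamma_sq hab, smul_neg]
  push_cast
  module

lemma expGate_zero (hab : a ≠ b) : expGate a b 0 = 1 := by
  simp [expGate_eq hab]

lemma expGate_conjTranspose (hab : a ≠ b) (θ : ℝ) : (expGate a b θ)ᴴ = expGate a b (-θ) := by
  rw [expGate_eq hab, expGate_eq hab, conjTranspose_sub, conjTranspose_smul, conjTranspose_smul,
    conjTranspose_one, gamma_mul_gamma_conjTranspose hab]
  simp only [Complex.star_def, Complex.conj_ofReal, Real.cos_neg, Real.sin_neg, Complex.ofReal_neg,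
    neg_smul, smul_neg]

lemma expGate_mem_unitaryGroup (hab : a ≠ b) (θ : ℝ) :
    expGate a b θ ∈ unitaryGroup (Qubits ℓ) ℂ := by
  rw [mem_unitaryGroup_iff, star_eq_conjTranspose, expGate_conjTranspose hab, expGate_mul hab,
    add_neg_cancel, expGate_zero hab]

lemma mul_expGate_of_commute {M : Matrix (Qubits ℓ) (Qubits ℓ) ℂ} (hab : a ≠ b)
    (h : gamma ℓ a * gamma ℓ b * M = M * (gamma ℓ a * gamma ℓ b)) (θ : ℝ) :
    expGate a b θ * M = M * expGate a b θ := by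
  rw [expGate_eq hab, sub_mul, mul_sub, smul_mul_assoc, smul_mul_assoc, h, mul_smul_comm,
    mul_smul_comm, one_mul, mul_one]

lemma mul_expGate_of_anticommute {M : Matrix (Qubits ℓ) (Qubits ℓ) ℂ} (hab : a ≠ b)
    (h : gamma ℓ a * gamma ℓ b * M = -(M * (gamma ℓ a * gamma ℓ b))) (θ : ℝ) :
    expGate a b θ * M = M * expGate a b (-θ) := by
  rw [expGate_eq hab, expGate_eq hab, sub_mul, mul_sub, smul_mul_assoc, smul_mul_assoc, h,
    mul_smul_comm, mul_smul_comm, one_mul, mul_one, Real.cos_neg, Real.sin_neg]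
  simp

/-- The operator `V` implements the linear map `g` on the Clifford matrices by conjugation. -/
def Implements (V : Matrix (Qubits ℓ) (Qubits ℓ) ℂ)
    (g : Matrix (Fin (2 * ℓ + 1)) (Fin (2 * ℓ + 1)) ℝ) : Prop :=
  ∀ a, Vᴴ * gamma ℓ a * V = ∑ m, (g a m : ℂ) • gamma ℓ m

variable {V W : Matrix (Qubits ℓ) (Qubits ℓ) ℂ}
  {g h : Matrix (Fin (2 * ℓ + 1)) (Fin (2 * ℓ + 1)) ℝ}

/-- Anticommuting with Γ_m extracts one coefficient. Thus `g` is determined by `V`, through an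
expression continuous in `V`. -/
lemma Implements.anticommutator (hV : Implements V g) (a m : Fin (2 * ℓ + 1)) :
    Vᴴ * gamma ℓ a * V * gamma ℓ m + gamma ℓ m * (Vᴴ * gamma ℓ a * V)
      = (2 * (g a m : ℂ)) • (1 : Matrix (Qubits ℓ) (Qubits ℓ) ℂ) := by
  rw [hV a, Finset.sum_mul, Finset.mul_sum, ← Finset.sum_add_distrib]
  simp only [smul_mul_assoc, mul_smul_comm, ← smul_add, gamma_mul_add_gamma_mul, smul_smul]
  rw [Finset.sum_eq_single m]
  · simp [mul_comm]
  · intro k _ hk; simp [hk]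
  · simp

lemma Implements.apply_eq (hV : Implements V g) (a m : Fin (2 * ℓ + 1)) :
    g a m = ((Vᴴ * gamma ℓ a * V * gamma ℓ m + gamma ℓ m * (Vᴴ * gamma ℓ a * V)) 0 0).re / 2 := by
  rw [hV.anticommutator]
  simp

lemma Implements.unique (hV : Implements V g) (hV' : Implements V h) : g = h := by
  ext a m
  rw [hV.apply_eq, hV'.apply_eq]

lemma Implements.mul (hV : Implements V g) (hW : Implements W h) :
    Implements (V * W) (g * h) := by
  intro a
  have : (V * W)ᴴ * gamma ℓ a * (V * W) = Wᴴ * (Vᴴ * gamma ℓ a * V) * W := by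
    simp only [conjTranspose_mul, mul_assoc]
  rw [this, hV a, Finset.mul_sum, Finset.sum_mul]
  simp only [mul_smul_comm, smul_mul_assoc, hW _, Finset.smul_sum, smul_smul]
  rw [Finset.sum_comm]
  simp only [mul_apply, ← Finset.sum_smul]
  push_cast
  rfl

lemma implements_one : Implements (1 : Matrix (Qubits ℓ) (Qubits ℓ) ℂ) 1 := by
  intro a
  simp [one_apply, ite_smul]

/-- Conjugation by a unitary preserves the Clifford relations, which say that the Γ_a are
orthonormal for half the anticommutator. -/
lemma Implements.mul_transpose (hV : Implements V g) (hVu : V * Vᴴ = 1) : g * gᵀ = 1 := by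
  ext a b
  have h1 : Vᴴ * gamma ℓ a * V * (Vᴴ * gamma ℓ b * V) + Vᴴ * gamma ℓ b * V * (Vᴴ * gamma ℓ a * V)
      = (if a = b then (2 : ℂ) else 0) • 1 := by
    have e : ∀ x y : Matrix (Qubits ℓ) (Qubits ℓ) ℂ,
        Vᴴ * x * V * (Vᴴ * y * V) = Vᴴ * (x * y) * V := by
      intro x y
      have : Vᴴ * x * V * (Vᴴ * y * V) = Vᴴ * x * (V * Vᴴ) * y * V := by
        simp only [mul_assoc]
      rw [this, hVu, mul_one, mul_assoc Vᴴ]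
    rw [e, e, ← add_mul, ← mul_add, gamma_mul_add_gamma_mul, mul_smul_comm, smul_mul_assoc,
      mul_one, mul_eq_one_comm.1 hVu]
  rw [hV b, Finset.mul_sum, Finset.sum_mul, ← Finset.sum_add_distrib] at h1
  simp only [mul_smul_comm, smul_mul_assoc, ← smul_add] at h1
  simp only [hV.anticommutator, smul_smul, ← Finset.sum_smul] at h1
  have h2 := congrArg Complex.re (congrFun (congrFun h1 0) 0)
  simp only [Matrix.smul_apply, one_apply_eq, smul_eq_mul, mul_one] at h2
  have h3 : (∑ x, (g b x : ℂ) * (2 * (g a x : ℂ))) = ((2 * (g * gᵀ) a b : ℝ) : ℂ) := by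
    simp only [mul_apply, transpose_apply, Finset.mul_sum]
    push_cast
    exact Finset.sum_congr rfl fun x _ => by ring
  rw [h3, Complex.ofReal_re] at h2
  rw [one_apply]
  split_ifs with hab
  · simp [hab] at h2 ⊢; linarith
  · simpa [hab] using h2

lemma Implements.mem_orthogonalGroup (hV : Implements V g) (hVu : V * Vᴴ = 1) :
    g ∈ orthogonalGroup (Fin (2 * ℓ + 1)) ℝ :=
  (mem_orthogonalGroup_iff _ _).2 (hV.mul_transpose hVu)

/-- The rotation by `θ` in the plane of the coordinates `a`, `b`. -/
def planeRot (a b : Fin (2 * ℓ + 1)) (θ : ℝ) : Matrix (Fin (2 * ℓ + 1)) (Fin (2 * ℓ + 1)) ℝ :=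
  of fun i j =>
    if i = a then Real.cos θ * (if j = a then 1 else 0) - Real.sin θ * (if j = b then 1 else 0)
    else if i = b then Real.sin θ * (if j = a then 1 else 0) + Real.cos θ * (if j = b then 1 else 0)
    else if j = i then 1 else 0

lemma planeRot_mul_apply (a b : Fin (2 * ℓ + 1)) (θ : ℝ) (i j : Fin (2 * ℓ + 1)) :
    (planeRot a b θ * g) i j = if i = a then Real.cos θ * g a j - Real.sin θ * g b j
      else if i = b then Real.sin θ * g a j + Real.cos θ * g b j else g i j := by
  rw [mul_apply]
  simp only [planeRot, of_apply]
  split_ifs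
  · simp [sub_mul, Finset.sum_sub_distrib]
  · simp [add_mul, Finset.sum_add_distrib]
  · simp

lemma gamma_mul_gamma_mul_gamma_of_ne {c : Fin (2 * ℓ + 1)} (hca : c ≠ a)
    (hcb : c ≠ b) : gamma ℓ a * gamma ℓ b * gamma ℓ c = gamma ℓ c * (gamma ℓ a * gamma ℓ b) := by
  rw [mul_assoc, gamma_anticomm hcb.symm, mul_neg, ← mul_assoc, gamma_anticomm hca.symm, neg_mul,
    neg_neg, mul_assoc]

lemma gamma_mul_gamma_mul_left (hab : a ≠ b) :
    gamma ℓ a * gamma ℓ b * gamma ℓ a = -(gamma ℓ a * (gamma ℓ a * gamma ℓ b)) := by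
  rw [mul_assoc, gamma_anticomm hab.symm, mul_neg]

lemma gamma_mul_gamma_mul_right (hab : a ≠ b) :
    gamma ℓ a * gamma ℓ b * gamma ℓ b = -(gamma ℓ b * (gamma ℓ a * gamma ℓ b)) := by
  nth_rewrite 1 [gamma_anticomm hab]
  rw [neg_mul, mul_assoc]

/-- Γ_c commutes with the gate for c ∉ {a, b}. Moving it past the gate inverts the angle for c ∈ {a,
b}, so the two half angles add up instead of cancelling. -/
lemma implements_expGate (hab : a ≠ b) (θ : ℝ) :
    Implements (expGate a b (θ / 2)) (planeRot a b θ) := by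
  intro c
  rw [expGate_conjTranspose hab]
  by_cases hca : c = a
  · subst hca
    rw [mul_expGate_of_anticommute hab (gamma_mul_gamma_mul_left hab), neg_neg, mul_assoc,
      expGate_mul hab, add_halves, expGate_eq hab, mul_sub, mul_smul_comm, mul_smul_comm, mul_one,
      ← mul_assoc, gamma_mul_self, one_mul]
    simp [planeRot, sub_smul, Finset.sum_sub_distrib, apply_ite Complex.ofReal]
  by_cases hcb : c = b
  · subst hcb
    rw [mul_expGate_of_anticommute hab (gamma_mul_gamma_mul_right hab), neg_neg, mul_assoc,
      expGate_mul hab, add_halves, expGate_eq hab, mul_sub, mul_smul_comm, mul_smul_comm, mul_one,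
      gamma_anticomm hab, mul_neg, ← mul_assoc, gamma_mul_self, one_mul]
    simp [planeRot, hca, add_smul, Finset.sum_add_distrib, apply_ite Complex.ofReal]
    abel
  · rw [mul_expGate_of_commute hab (gamma_mul_gamma_mul_gamma_of_ne hca hcb), mul_assoc,
      expGate_mul hab, neg_add_cancel, expGate_zero hab, mul_one]
    simp [planeRot, hca, hcb]

/-- The determinant is one because the rotation is the square of the orthogonal rotation by half the
angle. -/
lemma planeRot_mem (hab : a ≠ b) (θ : ℝ) :
    planeRot a b θ ∈ specialOrthogonalGroup (Fin (2 * ℓ + 1)) ℝ := by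
  have hu : ∀ η : ℝ, expGate a b η * (expGate a b η)ᴴ = 1 := fun η =>
    mem_unitaryGroup_iff.1 (expGate_mem_unitaryGroup hab η)
  have h1 := implements_expGate hab (θ / 2)
  have h2 := h1.mul h1
  rw [expGate_mul hab, add_halves] at h2
  rw [(implements_expGate hab θ).unique h2]
  rw [mem_specialOrthogonalGroup_iff]
  refine ⟨h2.mem_orthogonalGroup (hu _), ?_⟩
  have h3 := congrArg det (h1.mul_transpose (hu _))
  rwa [det_mul, det_transpose, det_one, ← det_mul] at h3

end Rotations

/-! ### Plane rotations generate `SO(2ℓ+1)` -/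

section Generation

variable {ℓ : ℕ}

/-- The columns of `g` with index at least `k` are those of the identity. -/
def FixesFrom (k : ℕ) (g : Matrix (Fin (2 * ℓ + 1)) (Fin (2 * ℓ + 1)) ℝ) : Prop :=
  ∀ i j : Fin (2 * ℓ + 1), k ≤ j → g i j = if i = j then 1 else 0

lemma FixesFrom.planeRot_mul {k : ℕ} {g : Matrix (Fin (2 * ℓ + 1)) (Fin (2 * ℓ + 1)) ℝ}
    (hg : FixesFrom k g) {a b : Fin (2 * ℓ + 1)} (ha : (a : ℕ) < k) (hb : (b : ℕ) < k) (θ : ℝ) :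
    FixesFrom k (planeRot a b θ * g) := by
  intro i j hj
  have h1 : a ≠ j := fun h => by subst h; omega
  have h2 : b ≠ j := fun h => by subst h; omega
  rw [planeRot_mul_apply, hg a j hj, hg b j hj, hg i j hj, if_neg h1, if_neg h2]
  by_cases hia : i = a
  · subst hia; simp [h1]
  by_cases hib : i = b
  · subst hib; simp [h2]
  simp [hia, hib]

lemma exists_rotation_angle (x y : ℝ) : ∃ θ : ℝ, Real.cos θ * x - Real.sin θ * y = 0 := by
  -- The polar angle: x = r sin θ and y = r cos θ.
  refine ⟨Complex.arg (y + x * Complex.I), ?_⟩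
  have h := Complex.norm_mul_exp_arg_mul_I (y + x * Complex.I)
  set r := ‖(y + x * Complex.I : ℂ)‖
  set θ := Complex.arg (y + x * Complex.I)
  have h1 := congrArg Complex.re h
  have h2 := congrArg Complex.im h
  simp [Complex.exp_ofReal_mul_I_re, Complex.exp_ofReal_mul_I_im] at h1 h2
  rw [← h1, ← h2]; ring

/-- Column `i` is the standard basis vector e_i, and column `K` is orthogonal to it. -/
lemma FixesFrom.apply_eq_zero {k : ℕ} {g : SO ℓ} (hg : FixesFrom (k + 1) g.1)
    {i K : Fin (2 * ℓ + 1)} (hK : (K : ℕ) = k) (hi : k < i) : g.1 i K = 0 := by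
  have h := (mem_orthogonalGroup_iff' _ _).1 ((mem_specialOrthogonalGroup_iff).1 g.2).1
  have h1 := congrFun (congrFun h i) K
  rw [mul_apply] at h1
  simp only [transpose_apply] at h1
  rw [Finset.sum_eq_single i] at h1
  · rw [hg i i hi, if_pos rfl, one_mul, one_apply, if_neg] at h1
    · exact h1
    · rintro rfl; omega
  · intro j _ hj
    rw [hg j i hi, if_neg hj, zero_mul]
  · simp

/-- Givens elimination: left multiplication by plane rotations turns the columns into those of the
identity, from the last to the first. Here `k` counts the columns still to be treated. -/
lemma mem_of_planeRot_mem {H : Subgroup (SO ℓ)}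
    (hH : ∀ a b θ, a ≠ b → ∃ r ∈ H, r.1 = planeRot a b θ) (g : SO ℓ) : g ∈ H := by
  suffices h : ∀ k ≤ 2 * ℓ + 1, ∀ g : SO ℓ, FixesFrom k g.1 → g ∈ H from
    h _ le_rfl g fun i j hj => absurd j.2 (by omega)
  intro k
  induction k with
  | zero =>
    intro _ g hg
    have : g = 1 := by
      ext i j
      rw [hg i j (Nat.zero_le _)]
      exact (one_apply ..).symm
    exact this ▸ H.one_mem
  | succ k ih =>
    intro hk g hg
    set K : Fin (2 * ℓ + 1) := ⟨k, by omega⟩ with hKdef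
    -- Rotations in the planes (M, K), M < K, clear column `K` above the diagonal one entry at a
    -- time; below the diagonal it vanishes by orthogonality.
    have step : ∀ m ≤ k, ∃ h ∈ H, FixesFrom (k + 1) (h * g).1 ∧
        ∀ i : Fin (2 * ℓ + 1), (i : ℕ) < m → (h * g).1 i K = 0 := by
      intro m
      induction m with
      | zero => exact fun _ => ⟨1, H.one_mem, by simpa using hg, fun i hi => absurd hi (by omega)⟩
      | succ m ihm =>
        intro hm
        obtain ⟨h, hh, hfix, hz⟩ := ihm (by omega)
        set M : Fin (2 * ℓ + 1) := ⟨m, by omega⟩ with hM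
        have hMK : M ≠ K := by
          intro h; have := congrArg Fin.val h; simp [hM, hKdef] at this; omega
        obtain ⟨θ, hθ⟩ := exists_rotation_angle ((h * g).1 M K) ((h * g).1 K K)
        obtain ⟨r, hr, hr'⟩ := hH M K θ hMK
        have e : (r * h * g).1 = planeRot M K θ * (h * g).1 := by
          rw [← hr', mul_assoc]; rfl
        refine ⟨r * h, H.mul_mem hr hh, ?_, fun i hi => ?_⟩
        · rw [e]
          exact hfix.planeRot_mul (by simp [hM]; omega) (by simp [hKdef]) θ
        · rw [e, planeRot_mul_apply]
          split_ifs with h1 h2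
          · exact hθ
          · exfalso; have := congrArg Fin.val h2; simp [hKdef] at this; omega
          · refine hz i ?_
            have : (i : ℕ) ≠ m := fun h => h1 (Fin.ext h)
            omega
    obtain ⟨h, hh, hfix, hz⟩ := step k le_rfl
    have hcol : ∀ i, i ≠ K → (h * g).1 i K = 0 := by
      intro i hi
      have : (i : ℕ) ≠ k := fun h => hi (Fin.ext h)
      rcases lt_or_gt_of_ne this with h1 | h1
      · exact hz i h1
      · exact hfix.apply_eq_zero rfl h1
    have hfixk : ∀ f : SO ℓ, FixesFrom (k + 1) f.1 → (∀ i, i ≠ K → f.1 i K = 0) → f.1 K K = 1 →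
        FixesFrom k f.1 := by
      intro f h1 h2 h3 i j hj
      rcases Nat.lt_or_ge k j with h4 | h4
      · exact h1 i j h4
      · have : j = K := Fin.ext (by simp [hKdef]; omega)
        subst this
        split_ifs with h5
        · rw [h5, h3]
        · exact h2 i h5
    have hconc : ∀ h ∈ H, FixesFrom k (h * g).1 → g ∈ H := fun h hh hf =>
      (H.mul_mem_cancel_left hh).1 (ih (by omega) (h * g) hf)
    by_cases hone : (h * g).1 K K = 1
    · exact hconc h hh (hfixk _ hfix hcol hone)
    have hsq : (h * g).1 K K * (h * g).1 K K = 1 := by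
      have h := (mem_orthogonalGroup_iff' _ _).1 ((mem_specialOrthogonalGroup_iff).1 (h * g).2).1
      have h1 := congrFun (congrFun h K) K
      rw [mul_apply, Finset.sum_eq_single K, transpose_apply, one_apply_eq] at h1
      · exact h1
      · intro j _ hj; rw [transpose_apply, hcol j hj, zero_mul]
      · simp
    have hneg : (h * g).1 K K = -1 := (mul_self_eq_one_iff.1 hsq).resolve_left hone
    rcases Nat.eq_zero_or_pos k with rfl | hkpos
    -- In the first column no coordinate is left to rotate with, but a diagonal entry -1 there would
    -- give determinant -1.
    · exfalso
      have hdiag : (h * g).1 = diagonal fun i => if i = K then -1 else 1 := by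
        ext i j
        by_cases hj : j = K
        · subst hj
          by_cases hi : i = K
          · rw [hi, hneg]; simp
          · rw [hcol i hi, diagonal_apply_ne _ hi]
        · have : 0 + 1 ≤ (j : ℕ) := by
            have : (j : ℕ) ≠ 0 := fun h => hj (Fin.ext h)
            omega
          rw [hfix i j this, diagonal_apply]
          by_cases hij : i = j
          · simp [hij, hj]
          · simp [hij]
      have hdet := ((mem_specialOrthogonalGroup_iff).1 (h * g).2).2
      rw [hdiag, det_diagonal] at hdet
      simp at hdet
      norm_num at hdet
    · have h0K : (0 : Fin (2 * ℓ + 1)) ≠ K := by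
        intro h; have := congrArg Fin.val h; simp [hKdef] at this; omega
      -- A half turn in the plane (0, K) corrects the sign of the diagonal entry. It also negates
      -- row 0, which is harmless because only later columns are settled and row 0 vanishes in
      -- column `K`.
      obtain ⟨r, hr, hr'⟩ := hH 0 K Real.pi h0K
      have e : (r * h * g).1 = planeRot 0 K Real.pi * (h * g).1 := by
        rw [← hr', mul_assoc]; rfl
      refine hconc (r * h) (H.mul_mem hr hh) (hfixk _ ?_ ?_ ?_)
      · rw [e]; exact hfix.planeRot_mul (by simp) (by simp [hKdef]) _
      · intro i hi
        rw [e, planeRot_mul_apply]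
        simp [hi, hcol i hi, hcol 0 h0K]
      · rw [e, planeRot_mul_apply]
        simp [h0K.symm, hneg]

end Generation

/-! ### Compactness of matrix groups -/

section Compactness

variable {n 𝕜 : Type} [Fintype n] [DecidableEq n] [RCLike 𝕜]

lemma isCompact_unitaryGroup : IsCompact (unitaryGroup n 𝕜 : Set (Matrix n n 𝕜)) := by
  have hb : IsCompact (Set.univ.pi fun _ : n => Set.univ.pi fun _ : n =>
      Metric.closedBall (0 : 𝕜) 1) :=
    isCompact_univ_pi fun _ => isCompact_univ_pi fun _ => isCompact_closedBall 0 1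
  refine hb.of_isClosed_subset ?_ fun U hU i _ j _ => ?_
  · have : (unitaryGroup n 𝕜 : Set (Matrix n n 𝕜)) = {A | A * Aᴴ = 1} :=
      Set.ext fun A => mem_unitaryGroup_iff
    rw [this]
    exact isClosed_eq (continuous_id.matrix_mul continuous_id.matrix_conjTranspose)
      continuous_const
  · simpa using entry_norm_bound_of_unitary hU i j

instance compactSpace_unitaryGroup : CompactSpace (unitaryGroup n 𝕜) :=
  isCompact_iff_compactSpace.1 isCompact_unitaryGroup

/-- The real case is the compactness of `SO ℓ`, needed in `isClosed_spinGroup`. -/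
instance compactSpace_specialUnitaryGroup : CompactSpace (specialUnitaryGroup n 𝕜) := by
  refine isCompact_iff_compactSpace.1 ?_
  have : (specialUnitaryGroup n 𝕜 : Set (Matrix n n 𝕜))
      = (unitaryGroup n 𝕜 : Set (Matrix n n 𝕜)) ∩ {A | A.det = 1} :=
    Set.ext fun A => mem_specialUnitaryGroup_iff
  rw [this]
  exact isCompact_unitaryGroup.inter_right
    (isClosed_eq continuous_id.matrix_det continuous_const)

end Compactness

/-! ### The group generated by the elementary gates -/

section SpinGroup

variable {ℓ : ℕ}

/-- The group generated by the unitaries `exp(-i θ Γ^{ab})`. -/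
def spinGroup (ℓ : ℕ) : Subgroup (unitaryGroup (Qubits ℓ) ℂ) :=
  Subgroup.closure {V | ∃ a b, a ≠ b ∧ ∃ θ : ℝ, V.1 = expGate a b θ}

/-- The gate `exp(-i θ Γ^{ab})` as a unitary. -/
def expUnitary {a b : Fin (2 * ℓ + 1)} (hab : a ≠ b) (θ : ℝ) : unitaryGroup (Qubits ℓ) ℂ :=
  ⟨expGate a b θ, expGate_mem_unitaryGroup hab θ⟩

lemma expUnitary_mem {a b : Fin (2 * ℓ + 1)} (hab : a ≠ b) (θ : ℝ) :
    expUnitary hab θ ∈ spinGroup ℓ :=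
  Subgroup.subset_closure ⟨a, b, hab, θ, rfl⟩

/-- The generating set is closed under inverses (θ ↦ -θ), so left multiplication by generators
suffices. -/
lemma spinGroup_induction {p : unitaryGroup (Qubits ℓ) ℂ → Prop} (one : p 1)
    (mul : ∀ (a b : Fin (2 * ℓ + 1)) (hab : a ≠ b) (θ : ℝ), ∀ V, p V → p (expUnitary hab θ * V))
    {V : unitaryGroup (Qubits ℓ) ℂ} (hV : V ∈ spinGroup ℓ) : p V := by
  induction hV using Subgroup.closure_induction_left with
  | one => exact one
  | mul_left x hx y _ hy =>
    obtain ⟨a, b, hab, θ, h⟩ := hx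
    have : x = expUnitary hab θ := Subtype.ext h
    exact this ▸ mul a b hab θ y hy
  | inv_mul_cancel x hx y _ hy =>
    obtain ⟨a, b, hab, θ, h⟩ := hx
    have : x⁻¹ = expUnitary hab (-θ) := by
      refine Subtype.ext ?_
      change star x.1 = expGate a b (-θ)
      rw [h, star_eq_conjTranspose, expGate_conjTranspose hab]
    exact this ▸ mul a b hab (-θ) y hy

lemma exists_implements {V : unitaryGroup (Qubits ℓ) ℂ} (hV : V ∈ spinGroup ℓ) :
    ∃ g : SO ℓ, Implements V.1 g.1 := by
  refine spinGroup_induction (p := fun V => ∃ g : SO ℓ, Implements V.1 g.1)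
    ⟨1, implements_one⟩ ?_ hV
  rintro a b hab θ V ⟨g, hg⟩
  refine ⟨⟨planeRot a b (2 * θ), planeRot_mem hab _⟩ * g, Implements.mul ?_ hg⟩
  have := implements_expGate hab (2 * θ)
  rwa [mul_div_cancel_left₀ θ two_ne_zero] at this

/-- The rotation of the Clifford matrices implemented by an element of the group generated by
the elementary gates. -/
def spinRotation (V : spinGroup ℓ) : SO ℓ := (exists_implements V.2).choose

lemma implements_spinRotation (V : spinGroup ℓ) : Implements V.1.1 (spinRotation V).1 :=
  (exists_implements V.2).choose_spec

lemma spinRotation_eq {V : spinGroup ℓ} {g : SO ℓ} (h : Implements V.1.1 g.1) :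
    spinRotation V = g :=
  Subtype.ext ((implements_spinRotation V).unique h)

/-- The covering homomorphism onto `SO(2ℓ+1)`. -/
def spinHom (ℓ : ℕ) : spinGroup ℓ →* SO ℓ where
  toFun := spinRotation
  map_one' := spinRotation_eq implements_one
  map_mul' V W := spinRotation_eq
    ((implements_spinRotation V).mul (implements_spinRotation W))

lemma implements_spinHom (V : spinGroup ℓ) : Implements V.1.1 (spinHom ℓ V).1 :=
  implements_spinRotation V

lemma spinHom_eq {V : spinGroup ℓ} {g : SO ℓ} (h : Implements V.1.1 g.1) : spinHom ℓ V = g :=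
  spinRotation_eq h

lemma spinHom_surjective : Function.Surjective (spinHom ℓ) := by
  intro g
  refine mem_of_planeRot_mem (H := (spinHom ℓ).range) (fun a b θ hab => ?_) g
  exact ⟨_, ⟨⟨_, expUnitary_mem hab (θ / 2)⟩, spinHom_eq (g := ⟨_, planeRot_mem hab θ⟩)
    (implements_expGate hab θ)⟩, rfl⟩

lemma implements_one_iff {V : unitaryGroup (Qubits ℓ) ℂ} :
    Implements V.1 1 ↔ ∃ c : ℂ, V.1 = c • (1 : Matrix (Qubits ℓ) (Qubits ℓ) ℂ) := by
  have hV : V.1ᴴ * V.1 = 1 := mem_unitaryGroup_iff'.1 V.2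
  have hV' : V.1 * V.1ᴴ = 1 := mem_unitaryGroup_iff.1 V.2
  constructor
  · intro h
    have hc : ∀ a, Commute V.1 (gamma ℓ a) := by
      intro a
      have h1 : V.1ᴴ * gamma ℓ a * V.1 = gamma ℓ a := by
        rw [h a, ← implements_one (ℓ := ℓ) a]; simp
      rw [Commute, SemiconjBy]
      nth_rewrite 1 [← h1]
      rw [← mul_assoc, ← mul_assoc, hV', one_mul]
    exact eq_smul_one_of_commute fun a b _ => (hc a).mul_right (hc b)
  · rintro ⟨c, h⟩ a
    have : V.1ᴴ * gamma ℓ a * V.1 = gamma ℓ a := by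
      nth_rewrite 2 [h]
      rw [mul_smul_comm, mul_one, ← smul_mul_assoc]
      have : c • V.1ᴴ = 1 := by rw [← hV]; nth_rewrite 3 [h]; simp
      rw [this, one_mul]
    rw [this]
    have h1 := implements_one (ℓ := ℓ) a
    simpa using h1

lemma neg_one_mem_spinGroup (hℓ : 1 ≤ ℓ) : (-1 : unitaryGroup (Qubits ℓ) ℂ) ∈ spinGroup ℓ := by
  have h01 : (⟨0, by omega⟩ : Fin (2 * ℓ + 1)) ≠ ⟨1, by omega⟩ := by simp
  have : expUnitary h01 Real.pi = -1 := by
    refine Subtype.ext ?_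
    change expGate _ _ _ = -1
    rw [expGate_eq h01]
    simp
  exact this ▸ expUnitary_mem h01 _

/-- Moving a transposed generator through `C` turns it into its inverse. -/
lemma spinGroup_charge {C : Matrix (Qubits ℓ) (Qubits ℓ) ℂ}
    (hC : ∀ a b, C * (gamma ℓ a * gamma ℓ b)ᵀ = gamma ℓ b * gamma ℓ a * C)
    {V : unitaryGroup (Qubits ℓ) ℂ} (hV : V ∈ spinGroup ℓ) : V.1 * C * V.1ᵀ = C := by
  refine spinGroup_induction (p := fun V => V.1 * C * V.1ᵀ = C) (by simp) ?_ hV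
  intro a b hab θ V ih
  have h1 : C * (expGate a b θ)ᵀ = expGate a b (-θ) * C := by
    rw [expGate_eq hab, expGate_eq hab, transpose_sub, transpose_smul, transpose_smul,
      transpose_one, mul_sub, mul_smul_comm, mul_smul_comm, hC, gamma_mul_gamma_symm hab,
      sub_mul, smul_mul_assoc, smul_mul_assoc, Real.cos_neg, Real.sin_neg]
    simp
  change expGate a b θ * V.1 * C * (expGate a b θ * V.1)ᵀ = C
  have e : expGate a b θ * V.1 * C * (expGate a b θ * V.1)ᵀ
      = expGate a b θ * (V.1 * C * V.1ᵀ * (expGate a b θ)ᵀ) := by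
    rw [transpose_mul]; simp only [mul_assoc]
  rw [e, ih, h1, ← mul_assoc, expGate_mul hab, add_neg_cancel, expGate_zero hab, one_mul]

lemma eq_one_or_neg_one_of_charge {C V : Matrix (Qubits ℓ) (Qubits ℓ) ℂ} (hC0 : C ≠ 0)
    (hV : V * C * Vᵀ = C) {c : ℂ} (hc : V = c • 1) : V = 1 ∨ V = -1 := by
  rw [hc, transpose_smul, transpose_one, mul_smul_comm, mul_one, smul_mul_assoc, one_mul,
    smul_smul] at hV
  have h1 : (c * c - 1) • C = 0 := by rw [sub_smul, hV, one_smul, sub_self]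
  rcases mul_self_eq_one_iff.1 (sub_eq_zero.1 ((smul_eq_zero.1 h1).resolve_right hC0)) with h | h
  · left; rw [hc, h, one_smul]
  · right; rw [hc, h, neg_one_smul]

/-- Multiplying `V` by a lift of g⁻¹ gives an operator that fixes every Γ_a, hence a scalar;
preserving `C` makes it ±1, and both signs lie in the group. -/
lemma mem_spinGroup_iff (hℓ : 1 ≤ ℓ) {C : Matrix (Qubits ℓ) (Qubits ℓ) ℂ} (hC0 : C ≠ 0)
    (hC : ∀ a b, C * (gamma ℓ a * gamma ℓ b)ᵀ = gamma ℓ b * gamma ℓ a * C)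
    {V : unitaryGroup (Qubits ℓ) ℂ} :
    V ∈ spinGroup ℓ ↔ V.1 * C * V.1ᵀ = C ∧ ∃ g : SO ℓ, Implements V.1 g.1 := by
  refine ⟨fun h => ⟨spinGroup_charge hC h, exists_implements h⟩, ?_⟩
  rintro ⟨hVC, g, hg⟩
  obtain ⟨W, hW⟩ := spinHom_surjective g⁻¹
  have hWV : Implements (V * W.1).1 1 := by
    have h1 := hg.mul (implements_spinHom W)
    rw [hW] at h1
    have h2 : g.1 * g⁻¹.1 = 1 := congrArg Subtype.val (mul_inv_cancel g)
    rwa [h2] at h1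
  obtain ⟨c, hc⟩ := implements_one_iff.1 hWV
  have hcharge : (V * W.1).1 * C * (V * W.1).1ᵀ = C := by
    change V.1 * W.1.1 * C * (V.1 * W.1.1)ᵀ = C
    have e : V.1 * W.1.1 * C * (V.1 * W.1.1)ᵀ = V.1 * (W.1.1 * C * W.1.1ᵀ) * V.1ᵀ := by
      rw [transpose_mul]; simp only [mul_assoc]
    rw [e, spinGroup_charge hC W.2, hVC]
  refine ((spinGroup ℓ).mul_mem_cancel_right W.2).1 ?_
  rcases eq_one_or_neg_one_of_charge hC0 hcharge hc with h | h
  · rw [show V * W.1 = 1 from Subtype.ext h]; exact one_mem _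
  · rw [show V * W.1 = -1 from Subtype.ext h]; exact neg_one_mem_spinGroup hℓ

/-- The existential over `SO ℓ` in `mem_spinGroup_iff` is a projection along a compact factor, so it
preserves closedness. -/
lemma isClosed_spinGroup (hℓ : 1 ≤ ℓ) :
    IsClosed (spinGroup ℓ : Set (unitaryGroup (Qubits ℓ) ℂ)) := by
  obtain ⟨C, hC0, hC⟩ := exists_charge_conjugation ℓ
  have hset : (spinGroup ℓ : Set (unitaryGroup (Qubits ℓ) ℂ))
      = {V | V.1 * C * V.1ᵀ = C} ∩
        Prod.fst '' {x : unitaryGroup (Qubits ℓ) ℂ × SO ℓ | Implements x.1.1 x.2.1} := by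
    ext V
    rw [SetLike.mem_coe, mem_spinGroup_iff hℓ hC0 hC]
    constructor
    · rintro ⟨h1, g, hg⟩; exact ⟨h1, (V, g), hg, rfl⟩
    · rintro ⟨h1, ⟨_, g⟩, hg, rfl⟩; exact ⟨h1, g, hg⟩
  rw [hset]
  refine IsClosed.inter ?_ ?_
  · exact isClosed_eq ((continuous_subtype_val.matrix_mul continuous_const).matrix_mul
      continuous_subtype_val.matrix_transpose) continuous_const
  · refine isClosedMap_fst_of_compactSpace _ ?_
    simp only [Implements, Set.ofPred_forall]
    refine isClosed_iInter fun a => isClosed_eq ?_ ?_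
    · have h : Continuous fun x : unitaryGroup (Qubits ℓ) ℂ × SO ℓ => x.1.1 :=
        continuous_subtype_val.comp continuous_fst
      exact (h.matrix_conjTranspose.matrix_mul continuous_const).matrix_mul h
    · refine continuous_finsetSum _ fun m _ => Continuous.fun_smul ?_ continuous_const
      have h : Continuous fun x : unitaryGroup (Qubits ℓ) ℂ × SO ℓ => x.2.1 :=
        continuous_subtype_val.comp continuous_snd
      exact Complex.continuous_ofReal.comp (h.matrix_elem a m)

lemma spinHom_continuous : Continuous (spinHom ℓ) := by
  refine Continuous.subtype_mk (f := fun V => (spinHom ℓ V).1) ?_ _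
  refine continuous_matrix fun a m => ?_
  have e : (fun V : spinGroup ℓ => (spinHom ℓ V).1 a m) = fun V : spinGroup ℓ =>
      ((V.1.1ᴴ * gamma ℓ a * V.1.1 * gamma ℓ m
        + gamma ℓ m * (V.1.1ᴴ * gamma ℓ a * V.1.1)) 0 0).re / 2 :=
    funext fun V => (implements_spinHom V).apply_eq a m
  rw [e]
  have h : Continuous fun V : spinGroup ℓ => V.1.1 :=
    continuous_subtype_val.comp continuous_subtype_val
  have h1 : Continuous fun V : spinGroup ℓ => V.1.1ᴴ * gamma ℓ a * V.1.1 :=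
    (h.matrix_conjTranspose.matrix_mul continuous_const).matrix_mul h
  have h2 := (h1.matrix_mul (continuous_const (y := gamma ℓ m))).add
    ((continuous_const (y := gamma ℓ m)).matrix_mul h1)
  exact (Complex.continuous_re.comp (h2.matrix_elem 0 0)).div_const 2

lemma spinHom_isQuotientMap (hℓ : 1 ≤ ℓ) : Topology.IsQuotientMap (spinHom ℓ) := by
  have : CompactSpace (spinGroup ℓ) :=
    isCompact_iff_compactSpace.1 (isClosed_spinGroup hℓ).isCompact
  exact spinHom_continuous.isClosedMap.isQuotientMap spinHom_continuous spinHom_surjective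

lemma spinHom_eq_one_iff_smul (V : spinGroup ℓ) :
    spinHom ℓ V = 1 ↔ ∃ c : ℂ, V.1.1 = c • (1 : Matrix (Qubits ℓ) (Qubits ℓ) ℂ) := by
  rw [← implements_one_iff]
  exact ⟨fun h => by simpa [h] using implements_spinHom V, fun h => spinHom_eq (g := 1) h⟩

lemma spinHom_eq_one_iff (V : spinGroup ℓ) :
    spinHom ℓ V = 1 ↔ V.1.1 = 1 ∨ V.1.1 = -1 := by
  rw [spinHom_eq_one_iff_smul]
  constructor
  · rintro ⟨c, hc⟩
    obtain ⟨C, hC0, hC⟩ := exists_charge_conjugation ℓ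
    exact eq_one_or_neg_one_of_charge hC0 (spinGroup_charge hC V.2) hc
  · rintro (h | h)
    · exact ⟨1, by rw [h, one_smul]⟩
    · exact ⟨-1, by rw [h, neg_one_smul]⟩

end SpinGroup

/-! ### Sums over pairs of indices -/

section Pairs

variable {ℓ : ℕ}

lemma sum_pair {M : Type} [AddCommMonoid M] (f : Fin (2 * ℓ + 1) → Fin (2 * ℓ + 1) → M) :
    ∑ p : Pair ℓ, f p.1.1 p.1.2 = ∑ m, ∑ n, if m < n then f m n else 0 := by
  rw [← Fintype.sum_prod_type' fun m n => if m < n then f m n else 0, ← Finset.sum_filter]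
  exact (Finset.sum_subtype _ (by simp) fun x : Fin (2 * ℓ + 1) × Fin (2 * ℓ + 1) =>
    f x.1 x.2).symm

lemma sum_sum_eq_sum_pair {M : Type} [AddCommMonoid M]
    (f : Fin (2 * ℓ + 1) → Fin (2 * ℓ + 1) → M) :
    ∑ m, ∑ n, f m n = ∑ p : Pair ℓ, (f p.1.1 p.1.2 + f p.1.2 p.1.1) + ∑ m, f m m := by
  rw [Finset.sum_add_distrib, sum_pair, sum_pair fun m n => f n m]
  have h : ∑ m, ∑ n, (if m < n then f n m else 0) = ∑ m, ∑ n, if n < m then f m n else 0 :=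
    Finset.sum_comm
  rw [h, ← Finset.sum_add_distrib, ← Finset.sum_add_distrib]
  refine Finset.sum_congr rfl fun m _ => ?_
  have h2 : f m m = ∑ n, if m = n then f m n else 0 := by simp
  rw [h2, ← Finset.sum_add_distrib, ← Finset.sum_add_distrib]
  refine Finset.sum_congr rfl fun n _ => ?_
  rcases lt_trichotomy m n with h3 | h3 | h3
  · simp [h3, h3.not_gt, h3.ne]
  · simp [h3]
  · simp [h3, h3.not_gt, h3.ne']

lemma card_pair (ℓ : ℕ) : Fintype.card (Pair ℓ) = ℓ * (2 * ℓ + 1) := by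
  -- Counting all index pairs: (2ℓ+1)² is twice the number of pairs plus the 2ℓ+1 diagonal ones.
  have h := sum_sum_eq_sum_pair (ℓ := ℓ) fun _ _ => (1 : ℕ)
  simp at h
  nlinarith

/-- The pair `p` has exactly one index in `{a, b}`. -/
def Crosses (a b : Fin (2 * ℓ + 1)) (p : Pair ℓ) : Prop :=
  ¬((p.1.1 = a ∨ p.1.1 = b) ↔ (p.1.2 = a ∨ p.1.2 = b))

open Classical in
-- With s the indicator of {a, b}, the sum of s m (1 - s n) over all ordered (m, n) counts every
-- crossing pair once, and it factors as 2 · (2ℓ + 1 - 2).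
lemma sum_crosses {a b : Fin (2 * ℓ + 1)} (hab : a ≠ b) :
    ∑ p : Pair ℓ, (if Crosses a b p then (1 : ℝ) else 0) = 2 * (2 * ℓ - 1) := by
  set s : Fin (2 * ℓ + 1) → ℝ := fun m => if m = a ∨ m = b then 1 else 0 with hs
  have h := sum_sum_eq_sum_pair (ℓ := ℓ) fun m n => s m * (1 - s n)
  have h1 : ∑ m, s m = 2 := by
    have : ∀ m, s m = (if m = a then 1 else 0) + if m = b then 1 else 0 := by
      intro m
      by_cases h1 : m = a
      · subst h1; simp [hs, hab]
      · simp [hs, h1]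
    simp only [this, Finset.sum_add_distrib, Finset.sum_ite_eq', Finset.mem_univ, if_true]
    norm_num
  have h2 : ∀ m, s m * (1 - s m) = 0 := by
    intro m; simp only [hs]; split_ifs <;> simp
  rw [← Finset.sum_mul_sum, Finset.sum_sub_distrib, h1] at h
  simp only [h2, Finset.sum_const_zero, add_zero] at h
  have h3 : ∀ p : Pair ℓ, s p.1.1 * (1 - s p.1.2) + s p.1.2 * (1 - s p.1.1)
      = if Crosses a b p then 1 else 0 := by
    intro p
    by_cases h1 : p.1.1 = a ∨ p.1.1 = b <;> by_cases h2 : p.1.2 = a ∨ p.1.2 = b <;>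
      simp [hs, Crosses, h1, h2]
  rw [← Finset.sum_congr rfl fun p _ => h3 p, ← h]
  simp
  ring

lemma exists_crosses (hℓ : 1 ≤ ℓ) {a b : Fin (2 * ℓ + 1)} (hab : a ≠ b) :
    ∃ p : Pair ℓ, Crosses a b p := by
  classical
  by_contra! h
  have h1 := sum_crosses hab
  simp only [h, if_false, Finset.sum_const_zero] at h1
  have : (1 : ℝ) ≤ ℓ := by exact_mod_cast hℓ
  linarith

/-! ### The operators `Γ^{ab}` -/

lemma gamma_mul_gamma_mul_gamma {a b : Fin (2 * ℓ + 1)} (hab : a ≠ b) (c : Fin (2 * ℓ + 1)) :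
    gamma ℓ a * gamma ℓ b * gamma ℓ c
      = (if c = a ∨ c = b then (-1 : ℂ) else 1) • (gamma ℓ c * (gamma ℓ a * gamma ℓ b)) := by
  by_cases h1 : c = a
  · subst h1; simp [gamma_mul_gamma_mul_left hab]
  by_cases h2 : c = b
  · subst h2; simp [gamma_mul_gamma_mul_right hab]
  · simp [h1, h2, gamma_mul_gamma_mul_gamma_of_ne h1 h2]

lemma gamma_mul_gamma_mul_pairOp {a b : Fin (2 * ℓ + 1)} (hab : a ≠ b) (p : Pair ℓ) :
    gamma ℓ a * gamma ℓ b * pairOp p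
      = ((if p.1.1 = a ∨ p.1.1 = b then (-1 : ℂ) else 1)
          * (if p.1.2 = a ∨ p.1.2 = b then (-1 : ℂ) else 1))
        • (pairOp p * (gamma ℓ a * gamma ℓ b)) := by
  rw [pairOp, gammaPair, mul_smul_comm, ← mul_assoc, gamma_mul_gamma_mul_gamma hab, smul_mul_assoc,
    mul_assoc (gamma ℓ p.1.1), gamma_mul_gamma_mul_gamma hab, mul_smul_comm, smul_mul_assoc,
    mul_assoc (gamma ℓ p.1.1)]
  simp only [smul_smul]
  congr 1
  ring

lemma Crosses.anticommute {a b : Fin (2 * ℓ + 1)} (hab : a ≠ b) {p : Pair ℓ}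
    (hp : Crosses a b p) :
    gamma ℓ a * gamma ℓ b * pairOp p = -(pairOp p * (gamma ℓ a * gamma ℓ b)) := by
  rw [gamma_mul_gamma_mul_pairOp hab]
  by_cases h1 : p.1.1 = a ∨ p.1.1 = b <;> by_cases h2 : p.1.2 = a ∨ p.1.2 = b <;>
    simp_all [Crosses]

lemma commute_of_not_crosses {a b : Fin (2 * ℓ + 1)} (hab : a ≠ b) {p : Pair ℓ}
    (hp : ¬Crosses a b p) :
    gamma ℓ a * gamma ℓ b * pairOp p = pairOp p * (gamma ℓ a * gamma ℓ b) := by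
  rw [gamma_mul_gamma_mul_pairOp hab]
  by_cases h1 : p.1.1 = a ∨ p.1.1 = b <;> by_cases h2 : p.1.2 = a ∨ p.1.2 = b <;>
    simp_all [Crosses]

lemma gammaPair_mul_self {a b : Fin (2 * ℓ + 1)} (hab : a ≠ b) :
    (gammaPair a b : Matrix (Qubits ℓ) (Qubits ℓ) ℂ) * gammaPair a b = 1 := by
  rw [gammaPair, smul_mul_smul_comm, gamma_mul_gamma_sq hab]
  simp

lemma gammaPair_conjTranspose {a b : Fin (2 * ℓ + 1)} (hab : a ≠ b) :
    (gammaPair a b : Matrix (Qubits ℓ) (Qubits ℓ) ℂ)ᴴ = gammaPair a b := by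
  rw [gammaPair, conjTranspose_smul, gamma_mul_gamma_conjTranspose hab]
  simp

lemma pairOp_mul_self (p : Pair ℓ) : pairOp p * pairOp p = 1 := gammaPair_mul_self p.2.ne

lemma pairOp_conjTranspose (p : Pair ℓ) : (pairOp p)ᴴ = pairOp p := gammaPair_conjTranspose p.2.ne

/-- The phase i is the same for all pairs, which is why it cancels between enacted operators and
byproducts. -/
lemma pairOp_eq_smul_expUnitary (p : Pair ℓ) :
    pairOp p = Complex.I • (expUnitary p.2.ne (Real.pi / 2)).1 := by
  change gammaPair _ _ = Complex.I • expGate _ _ _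
  rw [expGate_eq p.2.ne, gammaPair]
  simp

lemma expGate_pi_div_two {a b : Fin (2 * ℓ + 1)} (hab : a ≠ b) :
    expGate a b (-(Real.pi / 2)) = gamma ℓ a * gamma ℓ b := by
  rw [expGate_eq hab]
  simp [neg_smul]

end Pairs

/-! ### The adjoint representation -/

section Adjoint

variable {ℓ : ℕ}

/-- The symmetry condition: expanding the product of two rotated Clifford matrices, the diagonal
terms vanish because distinct rows of `g` are orthogonal, and the others antisymmetrize to the 2 × 2
minors of `g`. -/
lemma Implements.conj_pairOp {V : Matrix (Qubits ℓ) (Qubits ℓ) ℂ} {g : SO ℓ}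
    (hV : Implements V g.1) (hVu : V * Vᴴ = 1) (p : Pair ℓ) :
    Vᴴ * pairOp p * V = rotatedKraus pairOp (adjoint g) p := by
  have e : Vᴴ * pairOp p * V
      = -Complex.I • ((Vᴴ * gamma ℓ p.1.1 * V) * (Vᴴ * gamma ℓ p.1.2 * V)) := by
    rw [pairOp, gammaPair, mul_smul_comm, smul_mul_assoc]
    congr 1
    have : Vᴴ * gamma ℓ p.1.1 * V * (Vᴴ * gamma ℓ p.1.2 * V)
        = Vᴴ * gamma ℓ p.1.1 * (V * Vᴴ) * gamma ℓ p.1.2 * V := by simp only [mul_assoc]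
    rw [this, hVu, mul_one]
    simp only [mul_assoc]
  rw [e, hV, hV, Finset.sum_mul_sum, sum_sum_eq_sum_pair]
  have hdiag : ∑ m, (g.1 p.1.1 m : ℂ) • gamma ℓ m * (g.1 p.1.2 m : ℂ) • gamma ℓ m = 0 := by
    simp only [smul_mul_smul_comm, gamma_mul_self, ← Finset.sum_smul]
    have h := congrFun (congrFun (hV.mul_transpose hVu) p.1.1) p.1.2
    rw [mul_apply, one_apply_ne p.2.ne] at h
    simp only [transpose_apply] at h
    have h' : ∑ m, (g.1 p.1.1 m : ℂ) * (g.1 p.1.2 m : ℂ) = ((0 : ℝ) : ℂ) := by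
      rw [← h]; push_cast; rfl
    rw [h', Complex.ofReal_zero, zero_smul]
  rw [hdiag, add_zero, rotatedKraus, Finset.smul_sum]
  refine Finset.sum_congr rfl fun q _ => ?_
  rw [smul_mul_smul_comm, smul_mul_smul_comm, gamma_mul_gamma_symm q.2.ne, pairOp, gammaPair]
  simp only [adjoint, of_apply]
  push_cast
  module

/-- The Cauchy–Binet formula for 2 × 2 minors. -/
lemma adjoint_mul (g h : SO ℓ) : adjoint (g * h) = adjoint g * adjoint h := by
  ext p r
  rw [mul_apply]
  have hs := sum_sum_eq_sum_pair (ℓ := ℓ) fun m n => g.1 p.1.1 m * g.1 p.1.2 n *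
    (h.1 m r.1.1 * h.1 n r.1.2 - h.1 m r.1.2 * h.1 n r.1.1)
  have hd : ∀ m, g.1 p.1.1 m * g.1 p.1.2 m *
    (h.1 m r.1.1 * h.1 m r.1.2 - h.1 m r.1.2 * h.1 m r.1.1) = 0 := fun m => by ring
  simp only [hd, Finset.sum_const_zero, add_zero] at hs
  have hl : ∑ m, ∑ n, g.1 p.1.1 m * g.1 p.1.2 n *
      (h.1 m r.1.1 * h.1 n r.1.2 - h.1 m r.1.2 * h.1 n r.1.1)
      = (g.1 * h.1) p.1.1 r.1.1 * (g.1 * h.1) p.1.2 r.1.2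
        - (g.1 * h.1) p.1.1 r.1.2 * (g.1 * h.1) p.1.2 r.1.1 := by
    simp only [mul_apply, Finset.sum_mul_sum, ← Finset.sum_sub_distrib]
    exact Finset.sum_congr rfl fun m _ => Finset.sum_congr rfl fun n _ => by ring
  rw [hl] at hs
  have e : adjoint (g * h) p r = ((((g.1 * h.1) p.1.1 r.1.1 * (g.1 * h.1) p.1.2 r.1.2
        - (g.1 * h.1) p.1.1 r.1.2 * (g.1 * h.1) p.1.2 r.1.1 : ℝ)) : ℂ) := rfl
  rw [e, hs, Complex.ofReal_sum]
  refine Finset.sum_congr rfl fun q _ => ?_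
  simp only [adjoint, of_apply]
  push_cast
  ring

lemma pair_ext_iff {p q : Pair ℓ} : p = q ↔ p.1.1 = q.1.1 ∧ p.1.2 = q.1.2 := by
  rw [Subtype.ext_iff, Prod.ext_iff]

lemma pair_swap_ne (p q : Pair ℓ) : ¬(p.1.1 = q.1.2 ∧ p.1.2 = q.1.1) := by
  rintro ⟨h1, h2⟩
  have := p.2
  rw [h1, h2] at this
  exact this.not_gt q.2

lemma adjoint_one : adjoint (1 : SO ℓ) = 1 := by
  ext p q
  have e : adjoint (1 : SO ℓ) p q =
    (((1 : Matrix _ _ ℝ) p.1.1 q.1.1 * (1 : Matrix _ _ ℝ) p.1.2 q.1.2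
    - (1 : Matrix _ _ ℝ) p.1.1 q.1.2 * (1 : Matrix _ _ ℝ) p.1.2 q.1.1 : ℝ) : ℂ) := rfl
  have h := pair_swap_ne p q
  rw [e]
  simp only [one_apply, pair_ext_iff, ite_mul, one_mul, zero_mul, ← ite_and, h, if_false, sub_zero]
  split_ifs <;> simp

lemma adjoint_inv (g : SO ℓ) : adjoint g⁻¹ = (adjoint g)ᴴ := by
  ext p q
  have e : adjoint g⁻¹ p q = ((g.1 q.1.1 p.1.1 * g.1 q.1.2 p.1.2
    - g.1 q.1.2 p.1.1 * g.1 q.1.1 p.1.2 : ℝ) : ℂ) := rfl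
  rw [e, conjTranspose_apply, adjoint, of_apply, Complex.star_def, Complex.conj_ofReal]
  congr 1
  ring

lemma adjoint_mem_unitaryGroup (g : SO ℓ) : adjoint g ∈ unitaryGroup (Pair ℓ) ℂ := by
  rw [mem_unitaryGroup_iff, star_eq_conjTranspose, ← adjoint_inv, ← adjoint_mul, mul_inv_cancel,
    adjoint_one]

/-- The adjoint representation by unitary matrices. -/
def adjointHom (ℓ : ℕ) : SO ℓ →* unitaryGroup (Pair ℓ) ℂ where
  toFun g := ⟨adjoint g, adjoint_mem_unitaryGroup g⟩
  map_one' := Subtype.ext adjoint_one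
  map_mul' g h := Subtype.ext (adjoint_mul g h)

/-- The rotation that reverses all coordinates but `c`. -/
def flip (c : Fin (2 * ℓ + 1)) : SO ℓ :=
  ⟨diagonal fun i => if i = c then 1 else -1, by
    rw [mem_specialOrthogonalGroup_iff, mem_orthogonalGroup_iff, diagonal_transpose,
      diagonal_mul_diagonal, det_diagonal]
    constructor
    · rw [← diagonal_one]
      congr 1
      funext i
      split_ifs <;> simp
    · rw [Fintype.prod_eq_mul_prod_compl c, Finset.prod_congr rfl (g := fun _ => (-1 : ℝ))]
      · rw [Finset.prod_const, Finset.card_compl]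
        simp
      · intro i hi
        rw [if_neg]
        simpa using hi⟩

lemma adjoint_flip_mulVec (c : Fin (2 * ℓ + 1)) (v : Pair ℓ → ℂ) (p : Pair ℓ) :
    (adjoint (flip c) *ᵥ v) p = (if p.1.1 = c ∨ p.1.2 = c then -1 else 1) * v p := by
  rw [mulVec, dotProduct, Finset.sum_eq_single p]
  · have h := p.2.ne
    congr 1
    simp only [adjoint, of_apply, flip, diagonal_apply_eq, diagonal_apply_ne _ h,
      diagonal_apply_ne _ h.symm]
    by_cases h1 : p.1.1 = c
    · have h2 : p.1.2 ≠ c := fun h2 => h (h1.trans h2.symm)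
      simp [h1, h2]
    · by_cases h2 : p.1.2 = c <;> simp [h1, h2]
  · intro q _ hq
    have h1 : ¬(p.1.1 = q.1.1 ∧ p.1.2 = q.1.2) := fun h => hq (pair_ext_iff.2 h).symm
    have h2 := pair_swap_ne p q
    simp only [adjoint, of_apply, flip, diagonal_apply]
    rw [not_and_or] at h1 h2
    rcases h1 with h1 | h1 <;> rcases h2 with h2 | h2 <;> simp [h1, h2]
  · simp

/-- The permutation matrix of `σ`, with the sign that gives it determinant one. -/
def signedPerm (σ : Equiv.Perm (Fin (2 * ℓ + 1))) : SO ℓ :=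
  ⟨((Equiv.Perm.sign σ : ℤ) : ℝ) • σ.permMatrix ℝ, by
    have hs : ((Equiv.Perm.sign σ : ℤ) : ℝ) * ((Equiv.Perm.sign σ : ℤ) : ℝ) = 1 := by
      rcases Int.units_eq_one_or (Equiv.Perm.sign σ) with h | h <;> simp [h]
    rw [mem_specialOrthogonalGroup_iff, mem_orthogonalGroup_iff]
    constructor
    · rw [transpose_smul, smul_mul_smul_comm, hs, one_smul, transpose_permMatrix,
        ← permMatrix_mul, inv_mul_cancel, permMatrix_one]
    -- The dimension is odd, so the prefactor contributes one more sign of σ, cancelling det σ.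
    · rw [det_smul, det_permutation, Fintype.card_fin, pow_succ, pow_mul, sq, hs, one_pow, one_mul]
      exact hs⟩

/-- The adjoint matrix is quadratic in the rotation, so the sign prefactor drops out. -/
lemma adjoint_signedPerm_mulVec {σ : Equiv.Perm (Fin (2 * ℓ + 1))} {p q : Pair ℓ}
    (h1 : σ q.1.1 = p.1.1) (h2 : σ q.1.2 = p.1.2) :
    adjoint (signedPerm σ) *ᵥ Pi.single p 1 = Pi.single q 1 := by
  ext r
  have hs : ((Equiv.Perm.sign σ : ℤ) : ℝ) * ((Equiv.Perm.sign σ : ℤ) : ℝ) = 1 := by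
    rcases Int.units_eq_one_or (Equiv.Perm.sign σ) with h | h <;> simp [h]
  have hentry : ∀ i j, (signedPerm σ).1 i (σ j)
      = ((Equiv.Perm.sign σ : ℤ) : ℝ) * if i = j then 1 else 0 := by
    intro i j
    simp [signedPerm, Equiv.Perm.permMatrix, PEquiv.toMatrix_apply, Equiv.toPEquiv_apply]
  have h := pair_swap_ne r q
  rw [mulVec_single_one, col_apply, Pi.single_apply, adjoint, of_apply, ← h1, ← h2]
  simp only [hentry]
  have e : ∀ s x y z w : ℝ, s * s = 1 → s * x * (s * y) - s * z * (s * w) = x * y - z * w := by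
    intro s x y z w hs; linear_combination (x * y - z * w) * hs
  rw [e _ _ _ _ _ hs]
  simp only [pair_ext_iff, ite_mul, one_mul, zero_mul, ← ite_and, h, if_false, sub_zero]
  split_ifs <;> simp

lemma exists_perm_pair (p q : Pair ℓ) :
    ∃ σ : Equiv.Perm (Fin (2 * ℓ + 1)), σ q.1.1 = p.1.1 ∧ σ q.1.2 = p.1.2 := by
  -- The right-hand swap places the first index; the other one then places the second without moving
  -- the first.
  refine ⟨Equiv.swap (Equiv.swap q.1.1 p.1.1 q.1.2) p.1.2 * Equiv.swap q.1.1 p.1.1, ?_, ?_⟩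
  · rw [Equiv.Perm.mul_apply, Equiv.swap_apply_left, Equiv.swap_apply_of_ne_of_ne _ p.2.ne]
    intro h
    have h2 : Equiv.swap q.1.1 p.1.1 q.1.1 = Equiv.swap q.1.1 p.1.1 q.1.2 := by
      rw [Equiv.swap_apply_left]; exact h
    exact q.2.ne ((Equiv.swap q.1.1 p.1.1).injective h2)
  · rw [Equiv.Perm.mul_apply, Equiv.swap_apply_left]

/-- The projectors (1 - flip c)/2 keep the pairs containing c; applying two of them isolates one
basis vector of a nonzero invariant subspace. Signed permutations carry it to every other basis
vector. -/
lemma actsIrreducibly_adjoint (hℓ : 1 ≤ ℓ) : ActsIrreducibly (Set.range (adjoint (ℓ := ℓ))) := by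
  refine ⟨⟨⟨(⟨0, by omega⟩, ⟨1, by omega⟩), Fin.mk_lt_mk.2 Nat.one_pos⟩⟩, fun E hE => ?_⟩
  have hE' : ∀ (g : SO ℓ), ∀ v ∈ E, adjoint g *ᵥ v ∈ E := fun g => hE _ ⟨g, rfl⟩
  by_cases hbot : E = ⊥
  · exact .inl hbot
  obtain ⟨v, hv, hv0⟩ := E.ne_bot_iff.1 hbot
  obtain ⟨p, hp⟩ := Function.ne_iff.1 hv0
  have hstep : ∀ c, ∀ w ∈ E, (fun q : Pair ℓ => if q.1.1 = c ∨ q.1.2 = c then w q else 0) ∈ E := by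
    intro c w hw
    have := E.smul_mem (1 / 2 : ℂ) (E.sub_mem hw (hE' (flip c) w hw))
    convert this using 1
    funext q
    rw [Pi.smul_apply, Pi.sub_apply, adjoint_flip_mulVec]
    split_ifs
    · rw [smul_eq_mul]; ring
    · simp
  have hsingle : Pi.single p 1 ∈ E := by
    have := E.smul_mem (v p)⁻¹ (hstep p.1.2 _ (hstep p.1.1 v hv))
    convert this using 1
    funext q
    rw [Pi.single_apply, Pi.smul_apply, smul_eq_mul]
    by_cases hq : q = p
    · subst hq
      simpa using (inv_mul_cancel₀ hp).symm
    · rw [if_neg hq, ← ite_and, if_neg, mul_zero]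
      rintro ⟨h1, h2⟩
      have h3 := q.2.ne
      have h4 := p.2.ne
      rcases h1 with h1 | h1 <;> rcases h2 with h2 | h2
      · exact h4 (h2.symm.trans h1)
      · exact pair_swap_ne q p ⟨h1, h2⟩
      · exact hq (pair_ext_iff.2 ⟨h2, h1⟩)
      · exact h4 (h2.symm.trans h1)
  refine .inr (eq_top_iff.2 fun w _ => ?_)
  rw [pi_eq_sum_univ' w]
  refine E.sum_mem fun q _ => E.smul_mem _ ?_
  obtain ⟨σ, h1, h2⟩ := exists_perm_pair p q
  have := hE' (signedPerm σ) _ hsingle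
  rwa [adjoint_signedPerm_mulVec h1 h2] at this

end Adjoint

/-! ### Born probabilities -/

section Born

variable {ι κ : Type} [Fintype ι] [Fintype κ]

lemma normSq_eq_dotProduct (ψ : κ → ℂ) : (normSq ψ : ℂ) = star ψ ⬝ᵥ ψ := by
  simp only [normSq, dotProduct, Pi.star_apply, Complex.star_def, Complex.ofReal_sum]
  exact Finset.sum_congr rfl fun x _ => by rw [Complex.conj_mul', Complex.ofReal_pow]

lemma normSq_mulVec [DecidableEq κ] {U : Matrix κ κ ℂ} (hU : Uᴴ * U = 1) (ψ : κ → ℂ) :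
    normSq (U *ᵥ ψ) = normSq ψ := by
  have : (normSq (U *ᵥ ψ) : ℂ) = normSq ψ := by
    rw [normSq_eq_dotProduct, normSq_eq_dotProduct, star_mulVec, dotProduct_mulVec, vecMul_vecMul,
      hU, vecMul_one]
  exact_mod_cast this

lemma normSq_smul (c : ℂ) (ψ : κ → ℂ) : normSq (c • ψ) = ‖c‖ ^ 2 * normSq ψ := by
  simp only [normSq, Finset.mul_sum, Pi.smul_apply, smul_eq_mul, norm_mul, mul_pow]

/-- For each virtual component x, `W` acts unitarily on the vector i ↦ (A_i ψ)_x. -/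
lemma sum_normSq_rotatedKraus [DecidableEq ι] {W : Matrix ι ι ℂ} (hW : Wᴴ * W = 1)
    (A : ι → Matrix κ κ ℂ) (ψ : κ → ℂ) :
    ∑ i, normSq (rotatedKraus A W i *ᵥ ψ) = ∑ i, normSq (A i *ᵥ ψ) := by
  simp only [normSq]
  rw [Finset.sum_comm, Finset.sum_comm (f := fun i x => ‖(A i *ᵥ ψ) x‖ ^ 2)]
  refine Finset.sum_congr rfl fun x _ => ?_
  have h := normSq_mulVec hW fun i => (A i *ᵥ ψ) x
  simp only [normSq] at h
  rw [← h]
  refine Finset.sum_congr rfl fun i _ => ?_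
  congr 2
  rw [rotatedKraus, sum_mulVec, Finset.sum_apply]
  exact Finset.sum_congr rfl fun j _ => by rw [smul_mulVec, Pi.smul_apply, smul_eq_mul]

end Born

/-! ### Kraus operators, success probabilities and projections -/

section Kraus

variable {ℓ : ℕ}

lemma krausNorm_sq (ℓ : ℕ) : krausNorm ℓ ^ 2 = 1 / ((ℓ : ℝ) * (2 * ℓ + 1)) := by
  rw [krausNorm, div_pow, one_pow, Real.sq_sqrt (by positivity)]

lemma krausNorm_ne_zero (hℓ : 1 ≤ ℓ) : (krausNorm ℓ : ℂ) ≠ 0 := by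
  have : (0 : ℝ) < ℓ := by exact_mod_cast hℓ
  have h : krausNorm ℓ ≠ 0 := by
    rw [krausNorm]; positivity
  exact_mod_cast h

lemma normSq_akltTensor_mulVec (p : Pair ℓ) (ψ : Qubits ℓ → ℂ) :
    normSq (akltTensor ℓ p *ᵥ ψ) = 1 / ((ℓ : ℝ) * (2 * ℓ + 1)) * normSq ψ := by
  rw [akltTensor, smul_mulVec, normSq_smul, normSq_mulVec, Complex.norm_real, Real.norm_eq_abs,
    sq_abs, krausNorm_sq]
  rw [pairOp_conjTranspose, pairOp_mul_self]

lemma sum_akltTensor (hℓ : 1 ≤ ℓ) : ∑ p, (akltTensor ℓ p)ᴴ * akltTensor ℓ p = 1 := by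
  have h : ∀ p : Pair ℓ, (akltTensor ℓ p)ᴴ * akltTensor ℓ p = ((krausNorm ℓ ^ 2 : ℝ) : ℂ) • 1 := by
    intro p
    rw [akltTensor, conjTranspose_smul, smul_mul_smul_comm, pairOp_conjTranspose, pairOp_mul_self,
      Complex.star_def, Complex.conj_ofReal, ← Complex.ofReal_mul, sq]
  have hpos : (0 : ℝ) < ℓ := by exact_mod_cast hℓ
  simp only [h, Finset.sum_const, Finset.card_univ, card_pair]
  rw [← Nat.cast_smul_eq_nsmul ℂ, smul_smul, krausNorm_sq, ← Complex.ofReal_natCast,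
    ← Complex.ofReal_mul]
  have : ((ℓ * (2 * ℓ + 1) : ℕ) : ℝ) * (1 / ((ℓ : ℝ) * (2 * ℓ + 1))) = 1 := by
    push_cast
    exact mul_one_div_cancel (by positivity)
  rw [this, Complex.ofReal_one, one_smul]

lemma rotatedKraus_akltTensor (W : Matrix (Pair ℓ) (Pair ℓ) ℂ) (p : Pair ℓ) :
    rotatedKraus (akltTensor ℓ) W p = (krausNorm ℓ : ℂ) • rotatedKraus pairOp W p := by
  simp only [rotatedKraus, akltTensor, Finset.smul_sum]
  exact Finset.sum_congr rfl fun q _ => smul_comm _ _ _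

/-- The total over all outcomes is unchanged by `W` and the non-crossing terms are unchanged
individually, so the crossing ones keep their total. The operators enacted by crossing outcomes play
no role, so this serves gates and projections alike. -/
lemma eventProb_crosses {a b : Fin (2 * ℓ + 1)} (hab : a ≠ b) {W : Matrix (Pair ℓ) (Pair ℓ) ℂ}
    (hW : W ∈ unitaryGroup (Pair ℓ) ℂ)
    (h : ∀ p, ¬Crosses a b p → rotatedKraus (akltTensor ℓ) W p = akltTensor ℓ p)
    {ψ : Qubits ℓ → ℂ} (hψ : normSq ψ = 1) :
    eventProb (akltTensor ℓ) W ψ {p | Crosses a b p} = successProb ℓ := by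
  classical
  have h1 := sum_normSq_rotatedKraus (mem_unitaryGroup_iff'.1 hW) (akltTensor ℓ) ψ
  simp only [normSq_akltTensor_mulVec, hψ, mul_one] at h1
  have h2 : ∀ p : Pair ℓ, (if p ∈ {p | Crosses a b p} then
      normSq (rotatedKraus (akltTensor ℓ) W p *ᵥ ψ) else 0)
      = normSq (rotatedKraus (akltTensor ℓ) W p *ᵥ ψ) - 1 / ((ℓ : ℝ) * (2 * ℓ + 1))
        + (1 / ((ℓ : ℝ) * (2 * ℓ + 1))) * if Crosses a b p then 1 else 0 := by
    intro p
    by_cases hp : Crosses a b p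
    · simp [hp]
    · simp [hp, h p hp, normSq_akltTensor_mulVec, hψ]
  have h3 : eventProb (akltTensor ℓ) W ψ {p | Crosses a b p}
      = ∑ p : Pair ℓ, (if p ∈ {p | Crosses a b p} then
        normSq (rotatedKraus (akltTensor ℓ) W p *ᵥ ψ) else 0) := by
    unfold eventProb
    exact Finset.sum_congr rfl fun p _ => by congr
  rw [h3, Finset.sum_congr rfl fun p _ => h2 p, Finset.sum_add_distrib, Finset.sum_sub_distrib, h1,
    sub_self, zero_add, ← Finset.mul_sum, sum_crosses hab, successProb]
  ring

/-! ### The elementary gates -/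

lemma rotatedKraus_spinHom (V : spinGroup ℓ) (p : Pair ℓ) :
    rotatedKraus pairOp (adjoint (spinHom ℓ V)) p = V.1.1ᴴ * pairOp p * V.1.1 :=
  ((implements_spinHom V).conj_pairOp (mem_unitaryGroup_iff.1 V.1.2) p).symm

lemma expGate_conj_of_crosses {a b : Fin (2 * ℓ + 1)} (hab : a ≠ b) {p : Pair ℓ}
    (hp : Crosses a b p) (θ : ℝ) :
    (expGate a b (θ / 2))ᴴ * pairOp p * expGate a b (θ / 2) = pairOp p * expGate a b θ := by
  rw [expGate_conjTranspose hab, mul_expGate_of_anticommute hab (hp.anticommute hab), neg_neg,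
    mul_assoc, expGate_mul hab, add_halves]

lemma expGate_conj_of_not_crosses {a b : Fin (2 * ℓ + 1)} (hab : a ≠ b) {p : Pair ℓ}
    (hp : ¬Crosses a b p) (θ : ℝ) :
    (expGate a b θ)ᴴ * pairOp p * expGate a b θ = pairOp p := by
  rw [expGate_conjTranspose hab, mul_expGate_of_commute hab (commute_of_not_crosses hab hp),
    mul_assoc, expGate_mul hab, neg_add_cancel, expGate_zero hab, mul_one]

/-! ### Projective measurements of `Γ^{ab}` -/

/-- The pair with the two given distinct indices. -/
def sortPair {c d : Fin (2 * ℓ + 1)} (h : c ≠ d) : Pair ℓ :=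
  if h' : c < d then ⟨(c, d), h'⟩ else ⟨(d, c), lt_of_le_of_ne (not_lt.1 h') h.symm⟩

lemma sortPair_spec {c d : Fin (2 * ℓ + 1)} (h : c ≠ d) :
    ((sortPair h).1.1 = c ∧ (sortPair h).1.2 = d) ∨
      ((sortPair h).1.1 = d ∧ (sortPair h).1.2 = c) := by
  unfold sortPair
  split_ifs
  · exact .inl ⟨rfl, rfl⟩
  · exact .inr ⟨rfl, rfl⟩

/-- The exchange of `a` and `b` in a pair of indices. -/
def swapPair (a b : Fin (2 * ℓ + 1)) (p : Pair ℓ) : Pair ℓ :=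
  sortPair ((Equiv.swap a b).injective.ne p.2.ne)

lemma swapPair_spec (a b : Fin (2 * ℓ + 1)) (p : Pair ℓ) :
    ((swapPair a b p).1.1 = Equiv.swap a b p.1.1 ∧ (swapPair a b p).1.2 = Equiv.swap a b p.1.2) ∨
    ((swapPair a b p).1.1 = Equiv.swap a b p.1.2 ∧ (swapPair a b p).1.2 = Equiv.swap a b p.1.1) :=
  sortPair_spec _

lemma swapPair_swapPair (a b : Fin (2 * ℓ + 1)) (p : Pair ℓ) :
    swapPair a b (swapPair a b p) = p := by
  have h2 := swapPair_spec a b (swapPair a b p)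
  rcases swapPair_spec a b p with ⟨h1, h1'⟩ | ⟨h1, h1'⟩ <;> rw [h1, h1'] at h2 <;>
    simp only [Equiv.swap_apply_self] at h2 <;> rcases h2 with h2 | h2
  · exact pair_ext_iff.2 h2
  · exact absurd h2 (pair_swap_ne _ _)
  · exact absurd h2 (pair_swap_ne _ _)
  · exact pair_ext_iff.2 h2

lemma swap_mem_iff (a b c : Fin (2 * ℓ + 1)) :
    (Equiv.swap a b c = a ∨ Equiv.swap a b c = b) ↔ (c = a ∨ c = b) := by
  by_cases h1 : c = a
  · subst h1; simp
  by_cases h2 : c = b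
  · subst h2; simp
  · simp [Equiv.swap_apply_of_ne_of_ne h1 h2, h1, h2]

lemma crosses_swapPair {a b : Fin (2 * ℓ + 1)} {p : Pair ℓ} :
    Crosses a b (swapPair a b p) ↔ Crosses a b p := by
  unfold Crosses
  rcases swapPair_spec a b p with ⟨h1, h1'⟩ | ⟨h1, h1'⟩
  · rw [h1, h1', swap_mem_iff, swap_mem_iff]
  · rw [h1, h1', swap_mem_iff, swap_mem_iff, not_iff_not]
    exact ⟨Iff.symm, Iff.symm⟩

lemma gammaPair_eq_pairOp_sortPair {c d : Fin (2 * ℓ + 1)} (h : c ≠ d) :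
    ∃ s : ℂ, (s = 1 ∨ s = -1) ∧ gammaPair c d = s • pairOp (sortPair h) := by
  rcases sortPair_spec h with ⟨h1, h2⟩ | ⟨h1, h2⟩
  · exact ⟨1, .inl rfl, by rw [pairOp, h1, h2, one_smul]⟩
  · refine ⟨-1, .inr rfl, ?_⟩
    rw [pairOp, h1, h2, gammaPair, gammaPair, gamma_mul_gamma_symm h]
    simp

lemma expGate_conj_gamma {a b : Fin (2 * ℓ + 1)} (hab : a ≠ b) (c : Fin (2 * ℓ + 1)) :
    ∃ s : ℂ, (s = 1 ∨ s = -1) ∧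
      (expGate a b (Real.pi / 2 / 2))ᴴ * gamma ℓ c * expGate a b (Real.pi / 2 / 2)
        = s • gamma ℓ (Equiv.swap a b c) := by
  have h := implements_expGate hab (Real.pi / 2) c
  by_cases h1 : c = a
  · subst h1
    exact ⟨-1, .inr rfl, by rw [h]; simp [planeRot, apply_ite Complex.ofReal]⟩
  by_cases h2 : c = b
  · subst h2
    exact ⟨1, .inl rfl, by rw [h]; simp [planeRot, h1, apply_ite Complex.ofReal]⟩
  · refine ⟨1, .inl rfl, ?_⟩
    rw [h, Equiv.swap_apply_of_ne_of_ne h1 h2]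
    simp [planeRot, h1, h2]

/-- Conjugation of Γ^p by the quarter-turn gate is evaluated twice: factor by factor it exchanges a
and b up to signs, and as a whole it gives Γ^p exp(-iπΓ^{ab}/2) = -iΓ^pΓ^{ab}. -/
lemma Crosses.pairOp_swapPair {a b : Fin (2 * ℓ + 1)} (hab : a ≠ b) {p : Pair ℓ}
    (hp : Crosses a b p) : ∃ s : ℂ, (s = 1 ∨ s = -1) ∧
      pairOp (swapPair a b p) = (Complex.I * s) • (pairOp p * gammaPair a b) := by
  obtain ⟨s1, hs1, h1⟩ := expGate_conj_gamma hab p.1.1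
  obtain ⟨s2, hs2, h2⟩ := expGate_conj_gamma hab p.1.2
  obtain ⟨s3, hs3, h3⟩ :=
    gammaPair_eq_pairOp_sortPair ((Equiv.swap a b).injective.ne p.2.ne)
  have hu : expGate a b (Real.pi / 2 / 2) * (expGate a b (Real.pi / 2 / 2))ᴴ = 1 :=
    mem_unitaryGroup_iff.1 (expGate_mem_unitaryGroup (ℓ := ℓ) hab _)
  have h4 := expGate_conj_of_crosses hab hp (Real.pi / 2)
  set V : Matrix (Qubits ℓ) (Qubits ℓ) ℂ := expGate a b (Real.pi / 2 / 2)
  have h5 : Vᴴ * pairOp p * V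
      = -Complex.I • ((Vᴴ * gamma ℓ p.1.1 * V) * (Vᴴ * gamma ℓ p.1.2 * V)) := by
    rw [pairOp, gammaPair, mul_smul_comm, smul_mul_assoc]
    congr 1
    have : Vᴴ * gamma ℓ p.1.1 * V * (Vᴴ * gamma ℓ p.1.2 * V)
        = Vᴴ * gamma ℓ p.1.1 * (V * Vᴴ) * gamma ℓ p.1.2 * V := by simp only [mul_assoc]
    rw [this, hu, mul_one]
    simp only [mul_assoc]
  have h6 : expGate a b (Real.pi / 2)
      = -Complex.I • (gammaPair a b : Matrix (Qubits ℓ) (Qubits ℓ) ℂ) := by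
    rw [expGate_eq hab, gammaPair, smul_smul]
    simp
  have h7 : (s1 * s2 * s3) • pairOp (swapPair a b p)
      = -Complex.I • (pairOp p * gammaPair a b) := by
    rw [← mul_smul_comm, ← h6, ← h4, h5, h1, h2, smul_mul_smul_comm, smul_comm, mul_smul,
      swapPair, ← h3, gammaPair]
  have hs : s1 * s2 * s3 = 1 ∨ s1 * s2 * s3 = -1 := by
    rcases hs1 with rfl | rfl <;> rcases hs2 with rfl | rfl <;> rcases hs3 with rfl | rfl <;> simp
  rcases hs with h | h <;> rw [h] at h7
  · exact ⟨-1, .inr rfl, by rw [one_smul] at h7; rw [h7]; simp⟩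
  · refine ⟨1, .inl rfl, ?_⟩
    rw [neg_one_smul, neg_smul, neg_inj] at h7
    rw [h7, mul_one]

open Classical in
/-- The measurement basis that superposes the pairs exchanged by `a ↔ b`. -/
def projectionBasis (a b : Fin (2 * ℓ + 1)) : Matrix (Pair ℓ) (Pair ℓ) ℂ :=
  of fun p q => if Crosses a b p then
      ((1 / Real.sqrt 2 : ℝ) : ℂ) * ((if q = p then 1 else 0)
        + Complex.I * if q = swapPair a b p then 1 else 0)
    else if q = p then 1 else 0

lemma rotatedKraus_projectionBasis_of_crosses {κ : Type} (A : Pair ℓ → Matrix κ κ ℂ)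
    {a b : Fin (2 * ℓ + 1)} {p : Pair ℓ} (hp : Crosses a b p) :
    rotatedKraus A (projectionBasis a b) p
      = ((1 / Real.sqrt 2 : ℝ) : ℂ) • (A p + Complex.I • A (swapPair a b p)) := by
  classical
  simp only [rotatedKraus, projectionBasis, of_apply, hp, if_true, mul_smul, ← Finset.smul_sum,
    add_smul, Finset.sum_add_distrib, ite_smul, one_smul, zero_smul, Finset.sum_ite_eq',
    Finset.mem_univ]

lemma rotatedKraus_projectionBasis_of_not_crosses {κ : Type} (A : Pair ℓ → Matrix κ κ ℂ)
    {a b : Fin (2 * ℓ + 1)} {p : Pair ℓ} (hp : ¬Crosses a b p) :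
    rotatedKraus A (projectionBasis a b) p = A p := by
  classical
  simp only [rotatedKraus, projectionBasis, of_apply, hp, if_false, ite_smul, one_smul, zero_smul,
    Finset.sum_ite_eq', Finset.mem_univ, if_true]

lemma projectionBasis_mem_unitaryGroup (a b : Fin (2 * ℓ + 1)) :
    projectionBasis a b ∈ unitaryGroup (Pair ℓ) ℂ := by
  classical
  rw [mem_unitaryGroup_iff, star_eq_conjTranspose]
  have hsq : ((1 / Real.sqrt 2 : ℝ) : ℂ) * ((1 / Real.sqrt 2 : ℝ) : ℂ) = 1 / 2 := by
    rw [← Complex.ofReal_mul, div_mul_div_comm, Real.mul_self_sqrt (by norm_num)]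
    norm_num
  ext p r
  rw [mul_apply]
  by_cases hp : Crosses a b p
  · have e : ∀ f : Pair ℓ → ℂ, ∑ q, projectionBasis a b p q * f q
        = ((1 / Real.sqrt 2 : ℝ) : ℂ) * (f p + Complex.I * f (swapPair a b p)) := by
      intro f
      simp only [projectionBasis, of_apply, hp, if_true, mul_assoc, ← Finset.mul_sum, add_mul,
        Finset.sum_add_distrib, ite_mul, one_mul, zero_mul, Finset.sum_ite_eq', Finset.mem_univ]
    rw [e]
    simp only [conjTranspose_apply, projectionBasis, of_apply]
    by_cases hr : Crosses a b r
    · have h1 : swapPair a b p = swapPair a b r ↔ p = r :=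
        ⟨fun h => by rw [← swapPair_swapPair a b p, h, swapPair_swapPair], fun h => h ▸ rfl⟩
      have h2 : p = swapPair a b r ↔ swapPair a b p = r :=
        ⟨fun h => by rw [h, swapPair_swapPair], fun h => by rw [← h, swapPair_swapPair]⟩
      simp only [hr, if_true, h1, h2, star_mul', star_add, Complex.star_def, Complex.conj_ofReal,
        Complex.conj_I, apply_ite (starRingEnd ℂ), map_one, map_zero, one_apply]
      -- Here x and y are the indicators of p = r and p' = r, with p' the swapped pair; the relative
      -- phase i makes the y terms cancel.
      have : ∀ s x y : ℂ, s * s = 1 / 2 →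
          s * (s * (x + -Complex.I * y) + Complex.I * (s * (y + -Complex.I * x))) = x := by
        intro s x y hs
        linear_combination (2 * x - (Complex.I ^ 2 + 1) * x) * hs - x * (1 / 2) * Complex.I_sq
      exact this _ _ _ hsq
    · have h1 : p ≠ r := fun h => hr (h ▸ hp)
      have h2 : swapPair a b p ≠ r := fun h => hr (h ▸ crosses_swapPair.2 hp)
      simp [hr, h1, h2]
  · have e : ∀ f : Pair ℓ → ℂ, ∑ q, projectionBasis a b p q * f q = f p := by
      intro f
      simp only [projectionBasis, of_apply, hp, if_false, ite_mul, one_mul, zero_mul,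
        Finset.sum_ite_eq', Finset.mem_univ, if_true]
    rw [e, conjTranspose_apply]
    simp only [projectionBasis, of_apply]
    by_cases hr : Crosses a b r
    · have h1 : p ≠ r := fun h => hp (h ▸ hr)
      have h2 : p ≠ swapPair a b r := fun h => hp (h ▸ crosses_swapPair.2 hr)
      simp [hr, h1, h2]
    · simp [hr, one_apply, apply_ite (starRingEnd ℂ)]

lemma Crosses.rotatedKraus_projectionBasis {a b : Fin (2 * ℓ + 1)} (hab : a ≠ b) {p : Pair ℓ}
    (hp : Crosses a b p) : ∃ ε : ℂ, (ε = 1 ∨ ε = -1) ∧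
      rotatedKraus (akltTensor ℓ) (projectionBasis a b) p
        = ((krausNorm ℓ : ℂ) * ((1 / Real.sqrt 2 : ℝ) : ℂ) * 2) •
          (pairOp p * ((1 / 2 : ℂ) • (1 + ε • gammaPair a b))) := by
  obtain ⟨s, hs, h⟩ := hp.pairOp_swapPair hab
  -- The phase i of the basis vector meets the i in Γ^{p'} = isΓ^pΓ^{ab}, which gives -s.
  refine ⟨-s, by rcases hs with rfl | rfl <;> simp, ?_⟩
  rw [rotatedKraus_akltTensor, rotatedKraus_projectionBasis_of_crosses _ hp, h,
    smul_smul Complex.I, ← mul_assoc, Complex.I_mul_I, neg_one_mul, mul_smul_comm, mul_add,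
    mul_one, mul_smul_comm, smul_smul, smul_smul]
  congr 1
  ring

end Kraus

/-! ### Gates induced by measurements -/

section Induced

variable {ℓ : ℕ}

/-- Multilinear expansion of the ordered product of the rotated site operators. -/
lemma measuredAmplitude_mpsState {ι κ : Type} [Fintype ι] [DecidableEq ι] [Fintype κ]
    [DecidableEq κ] (A : ι → Matrix κ κ ℂ) {n : ℕ} (W : Fin n → Matrix ι ι ℂ) (i : Fin n → ι)
    (R L : κ → ℂ) : measuredAmplitude W i (mpsState A n R L)
      = star R ⬝ᵥ ((List.ofFn fun k => rotatedKraus A (W k) (i k)).prod *ᵥ L) := by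
  have h := (MultilinearMap.mkPiAlgebraFin ℂ n (Matrix κ κ ℂ)).map_sum
    fun k (j : ι) => W k (i k) j • A j
  simp only [MultilinearMap.map_smul_univ, MultilinearMap.mkPiAlgebraFin_apply] at h
  simp only [rotatedKraus, h, measuredAmplitude, mpsState]
  rw [sum_mulVec, dotProduct_sum]
  exact Finset.sum_congr rfl fun j _ => by rw [smul_mulVec, dotProduct_smul, smul_eq_mul]

lemma prod_ofFn_smul {κ : Type} [Fintype κ] [DecidableEq κ] {n : ℕ} (c : ℂ)
    (M : Fin n → Matrix κ κ ℂ) :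
    (List.ofFn fun k => c • M k).prod = c ^ n • (List.ofFn M).prod := by
  have h := (MultilinearMap.mkPiAlgebraFin ℂ n (Matrix κ κ ℂ)).map_smul_univ (fun _ => c) M
  simpa [MultilinearMap.mkPiAlgebraFin_apply] using h

lemma eq_of_dotProduct_mulVec {κ : Type} [Fintype κ] [DecidableEq κ] {M N : Matrix κ κ ℂ}
    (h : ∀ R L : κ → ℂ, star R ⬝ᵥ (M *ᵥ L) = star R ⬝ᵥ (N *ᵥ L)) : M = N := by
  ext x y
  have := h (Pi.single x 1) (Pi.single y 1)
  simpa using this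

lemma induces_iff (hℓ : 1 ≤ ℓ) {n : ℕ} {g : Fin n → SO ℓ} {i : Fin n → Pair ℓ}
    {G : Matrix (Qubits ℓ) (Qubits ℓ) ℂ} : Induces g i G ↔
      (List.ofFn fun k => rotatedKraus pairOp (adjoint (g k)) (i k)).prod = byproduct i * G := by
  have h : ∀ R L, measuredAmplitude (fun k => adjoint (g k)) i (akltState ℓ n R L)
      = (krausNorm ℓ : ℂ) ^ n * (star R ⬝ᵥ
        ((List.ofFn fun k => rotatedKraus pairOp (adjoint (g k)) (i k)).prod *ᵥ L)) := by
    intro R L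
    rw [akltState, measuredAmplitude_mpsState]
    simp only [rotatedKraus_akltTensor]
    rw [prod_ofFn_smul, smul_mulVec, dotProduct_smul, smul_eq_mul]
  constructor
  · intro hG
    refine eq_of_dotProduct_mulVec fun R L => ?_
    have := hG R L
    rw [h] at this
    exact mul_left_cancel₀ (pow_ne_zero _ (krausNorm_ne_zero hℓ)) this
  · intro hG R L
    rw [h, hG]

lemma prod_ofFn_coe {n : ℕ} (U : Fin n → unitaryGroup (Qubits ℓ) ℂ) :
    (List.ofFn fun k => (U k).1).prod = (List.ofFn U).prod.1 := by
  induction n with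
  | zero => simp
  | succ n ih =>
    simp only [List.ofFn_succ, List.prod_cons, ih fun k => U k.succ]
    rfl

lemma exists_prod_ofFn_eq {n : ℕ} {M : Fin n → Matrix (Qubits ℓ) (Qubits ℓ) ℂ}
    (h : ∀ k, ∃ U ∈ spinGroup ℓ, M k = Complex.I • U.1) :
    ∃ U ∈ spinGroup ℓ, (List.ofFn M).prod = Complex.I ^ n • U.1 := by
  choose U hU hM using h
  refine ⟨(List.ofFn U).prod, Subgroup.list_prod_mem _ ?_, ?_⟩
  · intro x hx
    obtain ⟨k, rfl⟩ := List.mem_ofFn.1 hx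
    exact hU k
  · rw [← prod_ofFn_coe, ← prod_ofFn_smul]
    congr 2
    exact funext hM

lemma exists_byproduct_eq {n : ℕ} (i : Fin n → Pair ℓ) :
    ∃ U ∈ spinGroup ℓ, byproduct i = Complex.I ^ n • U.1 :=
  exists_prod_ofFn_eq fun _ => ⟨_, expUnitary_mem _ _, pairOp_eq_smul_expUnitary _⟩

/-- Each rotated operator is W†Γ^pW with W a lift of g_k, hence i times a group element; the phase
i^n is shared with the byproduct. -/
lemma exists_mem_spinGroup_induces (hℓ : 1 ≤ ℓ) {n : ℕ} (g : Fin n → SO ℓ) (i : Fin n → Pair ℓ) :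
    ∃ V ∈ spinGroup ℓ, Induces g i V.1 := by
  obtain ⟨B, hB, hB'⟩ := exists_byproduct_eq i
  have hrot : ∀ k, ∃ U ∈ spinGroup ℓ,
      rotatedKraus pairOp (adjoint (g k)) (i k) = Complex.I • U.1 := by
    intro k
    obtain ⟨W, hW⟩ := spinHom_surjective (g k)
    refine ⟨W.1⁻¹ * expUnitary (i k).2.ne (Real.pi / 2) * W.1, mul_mem (mul_mem (inv_mem W.2)
      (expUnitary_mem _ _)) W.2, ?_⟩
    rw [← hW, rotatedKraus_spinHom, pairOp_eq_smul_expUnitary, mul_smul_comm, smul_mul_assoc]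
    rfl
  obtain ⟨U, hU, hU'⟩ := exists_prod_ofFn_eq hrot
  refine ⟨B⁻¹ * U, mul_mem (inv_mem hB) hU, (induces_iff hℓ).2 ?_⟩
  rw [hU', hB', smul_mul_assoc]
  congr 1
  have : U = B * (B⁻¹ * U) := by rw [mul_inv_cancel_left]
  exact congrArg Subtype.val this

lemma Induces.unique (hℓ : 1 ≤ ℓ) {n : ℕ} {g : Fin n → SO ℓ} {i : Fin n → Pair ℓ}
    {G G' : Matrix (Qubits ℓ) (Qubits ℓ) ℂ} (h : Induces g i G) (h' : Induces g i G') :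
    G = G' := by
  rw [induces_iff hℓ] at h h'
  rw [h] at h'
  obtain ⟨B, -, hB⟩ := exists_byproduct_eq i
  rw [hB, smul_mul_assoc, smul_mul_assoc] at h'
  have h1 := smul_right_injective _ (pow_ne_zero n Complex.I_ne_zero) h'
  have h2 : B.1ᴴ * B.1 = 1 := mem_unitaryGroup_iff'.1 B.2
  have h3 := congrArg (B.1ᴴ * ·) h1
  simpa only [← mul_assoc, h2, one_mul] using h3

lemma byproduct_commute_or_anticommute {a b : Fin (2 * ℓ + 1)} (hab : a ≠ b) {n : ℕ}
    (i : Fin n → Pair ℓ) :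
    gamma ℓ a * gamma ℓ b * byproduct i = byproduct i * (gamma ℓ a * gamma ℓ b) ∨
    gamma ℓ a * gamma ℓ b * byproduct i = -(byproduct i * (gamma ℓ a * gamma ℓ b)) := by
  induction n with
  | zero => left; simp [byproduct]
  | succ n ih =>
    have e : byproduct i = pairOp (i 0) * byproduct fun k => i k.succ := by
      simp [byproduct, List.ofFn_succ]
    rw [e, ← mul_assoc]
    by_cases hp : Crosses a b (i 0)
    · rw [hp.anticommute hab, neg_mul, mul_assoc]
      rcases ih fun k => i k.succ with h | h
      · right; rw [h, mul_assoc]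
      · left; rw [h, mul_neg, neg_neg, mul_assoc]
    · rw [commute_of_not_crosses hab hp, mul_assoc]
      rcases ih fun k => i k.succ with h | h
      · left; rw [h, mul_assoc]
      · right; rw [h, mul_neg, mul_assoc]

lemma exists_expGate_mul_byproduct {a b : Fin (2 * ℓ + 1)} (hab : a ≠ b) (θ : ℝ) {n : ℕ}
    (i : Fin n → Pair ℓ) : ∃ η : ℝ, expGate a b η * byproduct i = byproduct i * expGate a b θ := by
  rcases byproduct_commute_or_anticommute hab i with h | h
  · exact ⟨θ, mul_expGate_of_commute hab h θ⟩
  · exact ⟨-θ, by rw [mul_expGate_of_anticommute hab h, neg_neg]⟩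

/-- A new site is put in front of a record that induces `V`. With a crossing outcome p it enacts Γ^p
exp(-iηΓ^{ab}), where η = ±θ is chosen so that passing the byproduct of the remaining sites produces
the angle θ. -/
lemma mem_inducedGates_of_mem_spinGroup (hℓ : 1 ≤ ℓ) {V : unitaryGroup (Qubits ℓ) ℂ}
    (hV : V ∈ spinGroup ℓ) : V.1 ∈ inducedGates ℓ := by
  refine spinGroup_induction (p := fun V => V.1 ∈ inducedGates ℓ) ?_ ?_ hV
  · exact ⟨0, Fin.elim0, Fin.elim0, (induces_iff hℓ).2 (by simp [byproduct])⟩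
  · rintro a b hab θ V ⟨n, g, i, h⟩
    obtain ⟨p, hp⟩ := exists_crosses hℓ hab
    obtain ⟨η, hη⟩ := exists_expGate_mul_byproduct hab θ i
    refine ⟨n + 1, Fin.cons (spinHom ℓ ⟨_, expUnitary_mem hab (η / 2)⟩) g, Fin.cons p i,
      (induces_iff hℓ).2 ?_⟩
    have hby : byproduct (Fin.cons p i : Fin (n + 1) → Pair ℓ) = pairOp p * byproduct i := by
      simp [byproduct, List.ofFn_succ]
    rw [List.ofFn_succ, List.prod_cons, hby]
    simp only [Fin.cons_zero, Fin.cons_succ]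
    rw [(induces_iff hℓ).1 h, rotatedKraus_spinHom]
    change (expGate a b (η / 2))ᴴ * pairOp p * expGate a b (η / 2) * _ = _ * (expGate a b θ * V.1)
    rw [expGate_conj_of_crosses hab hp, mul_assoc, ← mul_assoc (expGate a b η), hη]
    simp only [mul_assoc]

lemma spinGroup_eq_inducedGates (hℓ : 1 ≤ ℓ) :
    {G : Matrix (Qubits ℓ) (Qubits ℓ) ℂ | ∃ V ∈ spinGroup ℓ, V.1 = G} = inducedGates ℓ := by
  ext G
  constructor
  · rintro ⟨V, hV, rfl⟩
    exact mem_inducedGates_of_mem_spinGroup hℓ hV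
  · rintro ⟨n, g, i, h⟩
    obtain ⟨V, hV, hV'⟩ := exists_mem_spinGroup_induces hℓ g i
    exact ⟨V, hV, hV'.unique hℓ h⟩

lemma actsIrreducibly_inducedGates (hℓ : 1 ≤ ℓ) : ActsIrreducibly (inducedGates ℓ) := by
  refine actsIrreducibly_of_gamma_mul_gamma fun a b hab => ?_
  rw [← expGate_pi_div_two hab]
  have h := mem_inducedGates_of_mem_spinGroup hℓ (expUnitary_mem hab (-(Real.pi / 2)))
  exact h

end Induced

end AKLT

end

/-! ### The main theorem -/

open AKLT Matrix in
theorem mainTheorem5 (ℓ : ℕ) (hℓ : 1 ≤ ℓ) :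
    -- dimensions and normalization of the matrix product state
    Fintype.card (Pair ℓ) = ℓ * (2 * ℓ + 1) ∧
    Fintype.card (Qubits ℓ) = 2 ^ ℓ ∧
    ∑ p, (akltTensor ℓ p)ᴴ * akltTensor ℓ p = 1 ∧
    -- the on-site space carries an irreducible unitary representation of `SO(2ℓ+1)`
    (∃ ρ : SO ℓ →* unitaryGroup (Pair ℓ) ℂ, ∀ g, (ρ g : Matrix (Pair ℓ) (Pair ℓ) ℂ) = adjoint g) ∧
    ActsIrreducibly (Set.range (adjoint (ℓ := ℓ))) ∧
    -- the induced gates form a group `𝒢`, which acts irreducibly on the virtual space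
    (∃ 𝒢 : Subgroup (unitaryGroup (Qubits ℓ) ℂ),
      {G : Matrix (Qubits ℓ) (Qubits ℓ) ℂ | ∃ V ∈ 𝒢, (V : Matrix (Qubits ℓ) (Qubits ℓ) ℂ) = G}
        = inducedGates ℓ ∧
      (∀ (n : ℕ) (g : Fin n → SO ℓ) (i : Fin n → Pair ℓ), ∃ V ∈ 𝒢, Induces g i V.1) ∧
      𝒢 = Subgroup.closure {V | ∃ a b, a ≠ b ∧ ∃ θ : ℝ, V.1 = expGate a b θ} ∧
      ActsIrreducibly (inducedGates ℓ) ∧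
      -- modulo global phases it is `SO(2ℓ+1)`, through the symmetry condition
      ∃ π : 𝒢 →* SO ℓ,
        Function.Surjective π ∧
        Topology.IsQuotientMap π ∧
        (∀ V : 𝒢, π V = 1 ↔
          ∃ c : ℂ, (V.1 : Matrix (Qubits ℓ) (Qubits ℓ) ℂ) = c • (1 : Matrix _ _ ℂ)) ∧
        (∀ V : 𝒢, π V = 1 ↔
          (V.1 : Matrix (Qubits ℓ) (Qubits ℓ) ℂ) = 1 ∨
          (V.1 : Matrix (Qubits ℓ) (Qubits ℓ) ℂ) = -1) ∧
        (∀ (V : 𝒢) (p : Pair ℓ),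
          rotatedKraus (akltTensor ℓ) (adjoint (π V)) p
            = (V.1 : Matrix (Qubits ℓ) (Qubits ℓ) ℂ)ᴴ * akltTensor ℓ p * V.1) ∧
        -- success probability of every nontrivial elementary gate `exp(-iθΓ^{ab})`
        (∀ a b : Fin (2 * ℓ + 1), a ≠ b → ∀ θ : ℝ,
          (¬ ∃ c : ℂ, expGate a b θ = c • (1 : Matrix (Qubits ℓ) (Qubits ℓ) ℂ)) →
          ∃ V : 𝒢, (V.1 : Matrix (Qubits ℓ) (Qubits ℓ) ℂ) = expGate a b (θ / 2) ∧
            (∀ p : Pair ℓ,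
              rotatedKraus (akltTensor ℓ) (adjoint (π V)) p = akltTensor ℓ p * expGate a b θ ∨
              rotatedKraus (akltTensor ℓ) (adjoint (π V)) p = akltTensor ℓ p) ∧
            ∀ ψ : Qubits ℓ → ℂ, normSq ψ = 1 →
              eventProb (akltTensor ℓ) (adjoint (π V)) ψ
                {p | rotatedKraus (akltTensor ℓ) (adjoint (π V)) p
                  = akltTensor ℓ p * expGate a b θ} = successProb ℓ)) ∧
    -- success probability of the projections onto the eigenspaces of `Γ^{ab}`
    (∀ a b : Fin (2 * ℓ + 1), a ≠ b →
      ∃ W ∈ unitaryGroup (Pair ℓ) ℂ, ∃ S : Set (Pair ℓ),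
        (∀ p ∈ S, ∃ (c : ℂ) (B : Matrix (Qubits ℓ) (Qubits ℓ) ℂ) (ε : ℂ),
          c ≠ 0 ∧ IsPauliOp B ∧ (ε = 1 ∨ ε = -1) ∧
          rotatedKraus (akltTensor ℓ) W p
            = c • (B * ((1 / 2 : ℂ) • (1 + ε • gammaPair a b)))) ∧
        (∀ p ∉ S, rotatedKraus (akltTensor ℓ) W p = akltTensor ℓ p) ∧
        ∀ ψ : Qubits ℓ → ℂ, normSq ψ = 1 →
          eventProb (akltTensor ℓ) W ψ S = successProb ℓ) ∧
    -- the byproducts `Γ^a Γ^b` and their products are tensor products of Pauli operators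
    (∀ a b : Fin (2 * ℓ + 1), a ≠ b → IsPauliOp (gamma ℓ a * gamma ℓ b)) ∧
    (∀ (n : ℕ) (i : Fin n → Pair ℓ), IsPauliOp (byproduct i)) := by
  refine ⟨card_pair ℓ, by simp, sum_akltTensor hℓ, ⟨adjointHom ℓ, fun _ => rfl⟩,
    actsIrreducibly_adjoint hℓ, ⟨spinGroup ℓ, spinGroup_eq_inducedGates hℓ,
      fun n g i => exists_mem_spinGroup_induces hℓ g i, rfl, actsIrreducibly_inducedGates hℓ,
      spinHom ℓ, spinHom_surjective, spinHom_isQuotientMap hℓ, spinHom_eq_one_iff_smul,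
      spinHom_eq_one_iff, fun V p => ?_, fun a b hab θ hθ => ?_⟩, fun a b hab => ?_,
    fun a b _ => (isPauliOp_gamma a).mul (isPauliOp_gamma b), fun n i => isPauliOp_byproduct i⟩
  · rw [rotatedKraus_akltTensor, rotatedKraus_spinHom, akltTensor, mul_smul_comm, smul_mul_assoc]
  · set V : spinGroup ℓ := ⟨_, expUnitary_mem hab (θ / 2)⟩
    have hc : ∀ p, Crosses a b p →
        rotatedKraus (akltTensor ℓ) (AKLT.adjoint (spinHom ℓ V)) p
          = akltTensor ℓ p * expGate a b θ := by
      intro p hp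
      rw [rotatedKraus_akltTensor, rotatedKraus_spinHom, akltTensor, smul_mul_assoc,
        ← expGate_conj_of_crosses hab hp]
      rfl
    have hn : ∀ p, ¬Crosses a b p →
        rotatedKraus (akltTensor ℓ) (AKLT.adjoint (spinHom ℓ V)) p = akltTensor ℓ p := by
      intro p hp
      rw [rotatedKraus_akltTensor, rotatedKraus_spinHom, akltTensor]
      congr 1
      exact expGate_conj_of_not_crosses hab hp (θ / 2)
    have hset : {p | rotatedKraus (akltTensor ℓ) (AKLT.adjoint (spinHom ℓ V)) p
        = akltTensor ℓ p * expGate a b θ} = {p | Crosses a b p} := by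
      ext p
      refine ⟨fun h => ?_, hc p⟩
      by_contra hp
      -- A non-crossing outcome enacts A_p, so counting it as a success would force the gate to be
      -- 𝟙. This is where nontriviality of the gate enters.
      refine hθ ⟨1, ?_⟩
      have h1 : akltTensor ℓ p = akltTensor ℓ p * expGate a b θ := (hn p hp).symm.trans h
      rw [akltTensor, smul_mul_assoc] at h1
      have h2 := congrArg (pairOp p * ·) (smul_right_injective _ (krausNorm_ne_zero hℓ) h1)
      simp only [← mul_assoc, pairOp_mul_self, one_mul] at h2
      rw [← h2, one_smul]
    refine ⟨V, rfl, fun p => ?_, fun ψ hψ => ?_⟩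
    · by_cases hp : Crosses a b p
      · exact .inl (hc p hp)
      · exact .inr (hn p hp)
    · rw [hset]
      exact eventProb_crosses hab (adjoint_mem_unitaryGroup _) hn hψ
  · have hn : ∀ p, ¬Crosses a b p →
        rotatedKraus (akltTensor ℓ) (projectionBasis a b) p = akltTensor ℓ p :=
      fun p hp => rotatedKraus_projectionBasis_of_not_crosses _ hp
    refine ⟨projectionBasis a b, projectionBasis_mem_unitaryGroup a b, {p | Crosses a b p},
      fun p hp => ?_, hn, fun ψ hψ =>
        eventProb_crosses hab (projectionBasis_mem_unitaryGroup a b) hn hψ⟩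
    obtain ⟨ε, hε, h⟩ := Crosses.rotatedKraus_projectionBasis hab hp
    refine ⟨_, pairOp p, ε, ?_, isPauliOp_pairOp p, hε, h⟩
    refine mul_ne_zero (mul_ne_zero (krausNorm_ne_zero hℓ) ?_) two_ne_zero
    rw [Complex.ofReal_ne_zero]
    positivity
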